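/- All graphs are simple and undirected with vertex set $[n]$. A (randomized, adaptive) algorithm has query access to an unknown graph $G$ through three oracles: a degree query at a vertex $v$ returns $\deg(v)$; a neighbor query at $v$ returns a uniformly random neighbor of $v$ (fresh randomness at each query), or a special symbol if $v$ is isolated; an independent-set (IS) query on a set $S\subseteq[n]$ returns whether $S$ is an independent set of $G$. Each next query is a function of the algorithm's internal randomness and of the previous answers, and the algorithm may stop at any time and output a real number $\widehat{m}$. Let $q(G)\in[0,\infty]$ be its expected number of queries on $G$, and let $\mathrm{succ}_\varepsilon(G)$ be the probability that it stops with an output satisfying $(1-\varepsilon)\,m(G)\le\widehat m\le(1+\varepsilon)\,m(G)$, where $m(G)$ is the number of edges of $G$. For $n,m\geq 1$ and $\varepsilon>0$ put $$R(n,m,\varepsilon)=\frac1{30}\min\left(\sqrt m,\ \sqrt{\frac{n}{\varepsilon\sqrt m}}\right).$$ Theorem. Let $n,m$ be integers with $1\le m\le\binom n2$ and let $0<\varepsilon\le 9/10$. For every algorithm as above (which may depend on $n$, $m$, $\varepsilon$) there is a graph $G$ on $[n]$ whose number of edges $m(G)$ satisfies $$\frac{1-\varepsilon}{1+\varepsilon}\,m-1\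 \le\ m(G)\ \le\ \frac{1+\varepsilon}{1-\varepsilon}\,m+1$$ and on which $$\mathrm{succ}_\varepsilon(G)\ \le\ \frac12+\frac{q(G)}{R(n,m,\varepsilon)}\qquad\text{and}\qquad \mathrm{succ}_\varepsilon(G)\ \le\ \frac12+\frac{q(G)}{R(n,m(G),\varepsilon)},$$ where for $m(G)=0$ we set $R(n,0,\varepsilon)=0$ and read $q(G)/0$ as $\infty$ if $q(G)>0$ and as $0$ if $q(G)=0$. -/

import Mathlib

open scoped ENNReal

noncomputable section

namespace EdgeEstimation

/-- The queries an algorithm may ask about a graph on the vertex set `Fin n`. -/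
inductive Query (n : ℕ) : Type
  | degree (v : Fin n) : Query n
  | neighbor (v : Fin n) : Query n
  | indepSet (S : Finset (Fin n)) : Query n

/-- The answers to queries; `neighbor none` is the special symbol for an isolated vertex. -/
inductive Answer (n : ℕ) : Type
  | degree (d : ℕ) : Answer n
  | neighbor (u : Option (Fin n)) : Answer n
  | indepSet (b : Bool) : Answer n

instance (n : ℕ) : MeasurableSpace (Query n) := ⊤

/-- The number of edges. -/
def edgeCount {n : ℕ} (G : SimpleGraph (Fin n)) : ℕ := G.edgeSet.ncard

open Classical in
/-- The distribution of the oracle's answer: the degree of `v`; a uniformly random neighbor of `v`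
(or the special symbol if there is none); whether `S` is an independent set. -/
def oracle {n : ℕ} (G : SimpleGraph (Fin n)) : Query n → PMF (Answer n)
  | .degree v => PMF.pure (.degree (G.degree v))
  | .neighbor v =>
      if h : (G.neighborFinset v).Nonempty then
        (PMF.uniformOfFinset (G.neighborFinset v) h).map fun u => .neighbor (some u)
      else PMF.pure (.neighbor none)
  | .indepSet S => PMF.pure (.indepSet (decide (G.IsIndepSet (S : Set (Fin n)))))

/-- A deterministic adaptive algorithm: from the answers received so far (most recent first), it
either chooses the next query or stops and outputs a real number. -/
abbrev DetAlgorithm (n : ℕ) : Type := List (Answer n) → Query n ⊕ ℝ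

/-- A randomized algorithm with internal randomness `ω : Ω`: a deterministic algorithm for every
`ω`, depending measurably on `ω`. -/
structure RandAlgorithm (n : ℕ) (Ω : Type*) [MeasurableSpace Ω] where
  next : Ω → DetAlgorithm n
  measurable_next : ∀ h : List (Answer n), Measurable fun ω => next ω h

namespace DetAlgorithm

variable {n : ℕ}

/-- One step of the execution on `G`, starting from the list `h` of answers received so far. The
randomness of every neighbor query is fresh. After the algorithm has stopped nothing changes. -/
def step (a : DetAlgorithm n) (G : SimpleGraph (Fin n)) (h : List (Answer n)) :
    PMF (List (Answer n)) :=
  match a h with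
  | .inl Q => (oracle G Q).map fun x => x :: h
  | .inr _ => PMF.pure h

/-- The distribution of the list of answers received within the first `t` steps. -/
def history (a : DetAlgorithm n) (G : SimpleGraph (Fin n)) : ℕ → PMF (List (Answer n))
  | 0 => PMF.pure []
  | t + 1 => (history a G t).bind (a.step G)

/-- The expected number of queries on `G`: the sum over `t` of the probability that the algorithm
asks a `(t + 1)`-st query. -/
def expectedQueries (a : DetAlgorithm n) (G : SimpleGraph (Fin n)) : ℝ≥0∞ :=
  ∑' t : ℕ, (history a G t).toOuterMeasure {h | ∃ Q, a h = .inl Q}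

/-- The probability that the algorithm stops on `G` with an output `x` such that
`(1 - ε) * m ≤ x ≤ (1 + ε) * m`, where `m` is the number of edges of `G`: the supremum (the limit)
over `t` of the probability that this has happened within `t` queries. -/
def successProb (a : DetAlgorithm n) (G : SimpleGraph (Fin n)) (ε : ℝ) : ℝ≥0∞ :=
  ⨆ t : ℕ, (history a G t).toOuterMeasure
    {h | ∃ x : ℝ, a h = .inr x ∧ (1 - ε) * edgeCount G ≤ x ∧ x ≤ (1 + ε) * edgeCount G}

end DetAlgorithm

namespace RandAlgorithm

variable {n : ℕ} {Ω : Type*} [MeasurableSpace Ω]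

/-- The expected number of queries on `G`, over the internal randomness, drawn from `P`, and the
randomness of the neighbor oracle. -/
def expectedQueries (A : RandAlgorithm n Ω) (P : MeasureTheory.Measure Ω)
    (G : SimpleGraph (Fin n)) : ℝ≥0∞ :=
  ∫⁻ ω, (A.next ω).expectedQueries G ∂P

/-- The probability, over the internal randomness, drawn from `P`, and the randomness of the
neighbor oracle, that the output is a `(1 ± ε)`-estimate of the number of edges of `G`. -/
def successProb (A : RandAlgorithm n Ω) (P : MeasureTheory.Measure Ω)
    (G : SimpleGraph (Fin n)) (ε : ℝ) : ℝ≥0∞ :=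
  ∫⁻ ω, (A.next ω).successProb G ε ∂P

end RandAlgorithm

/-- The quantity `R = (1/30) * min (√m) (√(n / (ε * √m)))`. -/
def rate (n m : ℕ) (ε : ℝ) : ℝ :=
  1 / 30 * min (Real.sqrt m) (Real.sqrt (n / (ε * Real.sqrt m)))

end EdgeEstimation

end

open scoped ENNReal

/-! ### Masses of sets under discrete distributions. -/

namespace PMF

/-! Let m₁ be the largest integer with (1+ε)m₁ < (1-ε)m, so that no output is good for both m and m₁
edges. Take graphs H, H' with these two edge counts (in either order) that differ only in a
well-hidden place, and rename both by the same uniformly random permutation. Until a query hits the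
difference, the runs on both graphs have the same law, so the two success probabilities add up to at
most 1 plus the probability of a hit. If each query asked on H hits with probability at most p on
average, and the run on H' is cut after τ queries by Markov's inequality, then on average succ(H) +
succ(H') ≤ 1 + p q(H) + q(H')/(τ+1) (`sum_successProb_le`). Integrating over the internal
randomness, some renaming of one of the two graphs satisfies the required bound
(`exists_permute_successProb_le`).

Dense case, n ≤ 16√m: H is a clique plus one partially joined vertex, with m edges, and H' lacks
some edges between two small sets of twins in the clique. The graph does not reveal which of its
twins are the special ones, so a hit has probability at most the share of special vertices among the
twins, which is of order √ε (`sum_successProb_le_of_twins`).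

Sparse case, n > 16√m: H is such a graph with m₁ edges, and H' has extra edges between sets W, D of
isolated vertices. Degree and neighbor queries hit W ∪ D rarely because there are many isolated
vertices. An independent-set query is read vertex by vertex until an edge appears, so it reads at
most two clique vertices. An unread isolated vertex can be exchanged with any unread clique vertex,
so each vertex of W is read with probability O(1/√m) (`mul_sum_history_touched_le`,
`sum_successProb_le_of_clique`). Only W matters here, so W is kept of size about √m/R and D carries
the rest of the product |W||D| ≥ m - m₁; the constraint |D| ≤ n/R then gives R² of order n/(ε√m).

If the rate is at most 1, the first query alone already pays. -/

theorem toOuterMeasure_apply_le_one {α : Type*} (p : PMF α) (s : Set α) :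
    p.toOuterMeasure s ≤ 1 := by
  rw [toOuterMeasure_apply, ← p.tsum_coe]
  exact ENNReal.tsum_le_tsum fun x => Set.indicator_le_self' (fun _ _ => zero_le) x

theorem toOuterMeasure_union_of_disjoint {α : Type*} (p : PMF α) {s t : Set α}
    (h : Disjoint s t) :
    p.toOuterMeasure (s ∪ t) = p.toOuterMeasure s + p.toOuterMeasure t := by
  simp only [toOuterMeasure_apply]
  rw [← ENNReal.tsum_add]
  refine tsum_congr fun x => ?_
  rw [Set.indicator_union_of_disjoint h]

theorem toOuterMeasure_add_compl {α : Type*} (p : PMF α) (s : Set α) :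
    p.toOuterMeasure s + p.toOuterMeasure sᶜ = 1 := by
  rw [← toOuterMeasure_union_of_disjoint p disjoint_compl_right, Set.union_compl_self,
    (toOuterMeasure_apply_eq_one_iff p _).2 (Set.subset_univ _)]

/-- A bound for the mass that `p.bind f` gives to `s` in terms of the mass that `p` gives to a set
outside of which `f` never reaches `s`. -/
theorem toOuterMeasure_bind_le {α β : Type*} (p : PMF α) (f : α → PMF β) {s : Set β} {t : Set α}
    (h : ∀ x ∉ t, (f x).toOuterMeasure s = 0) :
    (p.bind f).toOuterMeasure s ≤ p.toOuterMeasure t := by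
  rw [toOuterMeasure_bind_apply, toOuterMeasure_apply]
  refine ENNReal.tsum_le_tsum fun x => ?_
  by_cases hx : x ∈ t
  · rw [Set.indicator_of_mem hx]
    exact mul_le_of_le_one_right zero_le ((f x).toOuterMeasure_apply_le_one s)
  · simp [h x hx]

theorem map_apply_of_injective {α β : Type*} (p : PMF α) {f : α → β} (hf : Function.Injective f)
    (x : α) : (p.map f) (f x) = p x := by
  rw [map_apply, tsum_eq_single x]
  · simp
  · intro y hy
    simp [hf.eq_iff, hy.symm]

end PMF

namespace EdgeEstimation

/-! ### Runs of a deterministic algorithm on one graph and on two graphs. -/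

namespace DetAlgorithm

variable {n : ℕ} (a : DetAlgorithm n) (G G' : SimpleGraph (Fin n))

/-- The histories after which the algorithm asks another query. -/
def running : Set (List (Answer n)) := {h | ∃ Q, a h = .inl Q}

/-- No query asked along the history satisfies `hit`. -/
def Clean (hit : Query n → Prop) : List (Answer n) → Prop
  | [] => True
  | _ :: h => Clean hit h ∧ ∀ Q, a h = .inl Q → ¬ hit Q

variable {a} in
theorem step_of_inl {h : List (Answer n)} {Q : Query n} (hQ : a h = .inl Q) :
    a.step G h = (oracle G Q).map fun x => x :: h := by
  simp [step, hQ]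

variable {a} in
theorem step_of_notMem_running {h : List (Answer n)} (hh : h ∉ a.running) :
    a.step G h = PMF.pure h := by
  unfold step
  split
  · next Q hQ => exact (hh ⟨Q, hQ⟩).elim
  · rfl

theorem history_zero : a.history G 0 = PMF.pure [] := rfl

theorem history_succ (t : ℕ) : a.history G (t + 1) = (a.history G t).bind (a.step G) := rfl

/-- Outside `Y` the algorithm has stopped, so a history never enters `Y` later. -/
theorem antitone_history_of_running_subset {Y : Set (List (Answer n))} (hY : a.running ⊆ Y) :
    Antitone fun t => (a.history G t).toOuterMeasure Y := by
  refine antitone_nat_of_succ_le fun t => ?_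
  refine PMF.toOuterMeasure_bind_le _ _ fun h hh => ?_
  rw [step_of_notMem_running G fun hr => hh (hY hr), PMF.toOuterMeasure_pure_apply, if_neg hh]

theorem monotone_history_of_disjoint_running {X : Set (List (Answer n))}
    (hX : Disjoint X a.running) :
    Monotone fun t => (a.history G t).toOuterMeasure X := by
  refine monotone_nat_of_le_succ fun t => ?_
  rw [history_succ, PMF.toOuterMeasure_bind_apply, PMF.toOuterMeasure_apply]
  refine ENNReal.tsum_le_tsum fun h => ?_
  by_cases hh : h ∈ X
  · rw [step_of_notMem_running G (Set.disjoint_left.1 hX hh), PMF.toOuterMeasure_pure_apply,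
      if_pos hh, mul_one, Set.indicator_of_mem hh]
  · simp [hh]

/-- A run that ends in `X` after time `τ` is still running at time `τ`. -/
theorem iSup_history_le {X : Set (List (Answer n))} (hX : Disjoint X a.running) (τ : ℕ) :
    ⨆ t, (a.history G t).toOuterMeasure X ≤ (a.history G τ).toOuterMeasure (X ∪ a.running) := by
  refine iSup_le fun t => ?_
  refine (monotone_history_of_disjoint_running a G hX (le_max_left t τ)).trans ?_
  refine (MeasureTheory.measure_mono
    (Set.subset_union_left (t := a.running))).trans ?_
  exact antitone_history_of_running_subset a G Set.subset_union_right (le_max_right t τ)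

theorem sum_history_running_le (τ : ℕ) :
    ∑ t ∈ Finset.range τ, (a.history G t).toOuterMeasure a.running ≤ a.expectedQueries G :=
  ENNReal.sum_le_tsum _

/-- Markov's inequality for the number of queries: the probability of still running decreases in
time, so each of the first `τ + 1` terms of the expectation is at least the last one. -/
theorem mul_history_running_le (τ : ℕ) :
    ((τ + 1 : ℕ) : ℝ≥0∞) * (a.history G τ).toOuterMeasure a.running ≤ a.expectedQueries G := by
  refine le_trans ?_ (sum_history_running_le a G (τ + 1))
  rw [← nsmul_eq_mul]
  conv_lhs => rw [← Finset.card_range (τ + 1)]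
  refine Finset.card_nsmul_le_sum _ _ _ fun t ht => ?_
  exact antitone_history_of_running_subset a G subset_rfl
    (Nat.lt_succ_iff.1 (Finset.mem_range.1 ht))

/-- If along the histories in a set closed under removing the last answer the two oracles answer
with the same probabilities, then such histories have the same probabilities. -/
theorem history_apply_eq {good : List (Answer n) → Prop}
    (hgood : ∀ x h Q, good (x :: h) → a h = .inl Q → good h ∧ oracle G Q x = oracle G' Q x)
    (t : ℕ) {l : List (Answer n)} (hl : good l) : a.history G t l = a.history G' t l := by
  induction t generalizing l with
  | zero => rfl
  | succ t ih =>
    rw [history_succ, history_succ, PMF.bind_apply, PMF.bind_apply]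
    refine tsum_congr fun h => ?_
    by_cases hh : h ∈ a.running
    · obtain ⟨Q, hQ⟩ := hh
      rw [step_of_inl G hQ, step_of_inl G' hQ]
      by_cases hx : ∃ x, l = x :: h
      · obtain ⟨x, rfl⟩ := hx
        obtain ⟨h1, h2⟩ := hgood x h Q hl hQ
        have hinj : Function.Injective fun x : Answer n => x :: h := fun _ _ h => by simpa using h
        have e1 := (oracle G Q).map_apply_of_injective hinj x
        have e2 := (oracle G' Q).map_apply_of_injective hinj x
        rw [e1, e2, h2, ih h1]
      · have key : ∀ p : PMF (Answer n), (p.map fun x => x :: h) l = 0 := by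
          intro p
          rw [PMF.map_apply]
          refine ENNReal.tsum_eq_zero.2 fun x => if_neg fun e => hx ⟨x, e⟩
        rw [key, key, mul_zero, mul_zero]
    · rw [step_of_notMem_running G hh, step_of_notMem_running G' hh]
      by_cases e : l = h
      · subst e; rw [ih hl]
      · simp [PMF.pure_apply, e]

/-- Serves for facts that hold only along histories of positive probability, such as that an
isolated vertex is never returned as a neighbor. -/
theorem history_support_induction {motive : ℕ → List (Answer n) → Prop}
    (nil : motive 0 []) (stay : ∀ t h, motive t h → motive (t + 1) h)
    (cons : ∀ t x h Q, motive t h → a h = .inl Q → oracle G Q x ≠ 0 → motive (t + 1) (x :: h))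
    {t : ℕ} {l : List (Answer n)} (hl : a.history G t l ≠ 0) : motive t l := by
  induction t generalizing l with
  | zero =>
    rw [history_zero, PMF.pure_apply] at hl
    have : l = [] := by by_contra e; simp [e] at hl
    exact this ▸ nil
  | succ t ih =>
    rw [history_succ, ← PMF.mem_support_iff, PMF.mem_support_bind_iff] at hl
    obtain ⟨h, hh, hl⟩ := hl
    by_cases hr : h ∈ a.running
    · obtain ⟨Q, hQ⟩ := hr
      rw [step_of_inl G hQ, PMF.mem_support_map_iff] at hl
      obtain ⟨x, hx, rfl⟩ := hl
      exact cons t x h Q (ih hh) hQ hx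
    · rw [step_of_notMem_running G hr, PMF.mem_support_pure_iff] at hl
      exact hl ▸ stay t h (ih hh)

theorem length_le_of_history_ne_zero {t : ℕ} {l : List (Answer n)} (hl : a.history G t l ≠ 0) :
    l.length ≤ t := by
  refine history_support_induction a G (motive := fun t l => l.length ≤ t) le_rfl
    (fun t h hh => hh.trans (Nat.le_succ t)) (fun t x h Q hh _ _ => ?_) hl
  simpa using hh

/-- Union bound over the time of the first hit. Keeping `Clean` in the events lets later estimates
assume that nothing was hit before. -/
theorem history_not_clean_le (hit : Query n → Prop) (τ : ℕ) :
    (a.history G τ).toOuterMeasure {h | ¬ a.Clean hit h} ≤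
      ∑ t ∈ Finset.range τ, (a.history G t).toOuterMeasure
        {h | a.Clean hit h ∧ ∃ Q, a h = .inl Q ∧ hit Q} := by
  induction τ with
  | zero => simp [history_zero, PMF.toOuterMeasure_pure_apply, Clean]
  | succ t ih =>
    rw [Finset.sum_range_succ]
    refine le_trans ?_ (add_le_add_left ih _)
    refine le_trans ?_ (MeasureTheory.measure_union_le _ _)
    refine PMF.toOuterMeasure_bind_le _ _ fun h hh => ?_
    simp only [Set.mem_union, Set.mem_ofPred_eq, not_or, not_not, not_and, not_exists] at hh
    obtain ⟨hc, hn⟩ := hh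
    by_cases hr : h ∈ a.running
    · obtain ⟨Q, hQ⟩ := hr
      rw [step_of_inl G hQ, PMF.toOuterMeasure_map_apply]
      have : (fun x : Answer n => x :: h) ⁻¹' {h | ¬ a.Clean hit h} = ∅ := by
        ext x
        simp only [Set.mem_preimage, Set.mem_ofPred_eq, Clean, Set.mem_empty_iff_false, iff_false,
          not_not]
        exact ⟨hc, hn hc⟩
      rw [this, MeasureTheory.measure_empty]
    · rw [step_of_notMem_running G hr, PMF.toOuterMeasure_pure_apply, if_neg (by simpa using hc)]

variable {G G'} in
theorem history_apply_eq_of_clean {hit : Query n → Prop}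
    (hhit : ∀ Q, ¬ hit Q → oracle G Q = oracle G' Q) (t : ℕ) {l : List (Answer n)}
    (hl : a.Clean hit l) : a.history G t l = a.history G' t l :=
  history_apply_eq a G G' (fun _ _ Q hx hQ => ⟨hx.1, by rw [hhit Q (hx.2 Q hQ)]⟩) t hl

-- Clean histories have the same probability on both graphs, hence so has the event of a hit. Thus
-- the cost of a hit can be measured on `G` alone.
variable {G G'} in
theorem history_le_add_not_clean {hit : Query n → Prop}
    (hhit : ∀ Q, ¬ hit Q → oracle G Q = oracle G' Q) (t : ℕ) (X : Set (List (Answer n))) :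
    (a.history G' t).toOuterMeasure X ≤
      (a.history G t).toOuterMeasure X + (a.history G t).toOuterMeasure {h | ¬ a.Clean hit h} := by
  have key : ∀ Y : Set (List (Answer n)), Y ⊆ {h | a.Clean hit h} →
      (a.history G' t).toOuterMeasure Y = (a.history G t).toOuterMeasure Y := by
    intro Y hY
    rw [PMF.toOuterMeasure_apply, PMF.toOuterMeasure_apply]
    refine tsum_congr fun h => ?_
    by_cases hh : h ∈ Y
    · rw [Set.indicator_of_mem hh, Set.indicator_of_mem hh,
        history_apply_eq_of_clean a hhit t (hY hh)]
    · simp [hh]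
  have hcompl : (a.history G' t).toOuterMeasure {h | ¬ a.Clean hit h} =
      (a.history G t).toOuterMeasure {h | ¬ a.Clean hit h} := by
    have e1 := (a.history G t).toOuterMeasure_add_compl {h | a.Clean hit h}
    have e2 := (a.history G' t).toOuterMeasure_add_compl {h | a.Clean hit h}
    rw [key _ subset_rfl, ← e1] at e2
    refine (ENNReal.add_right_inj ?_).1 e2
    exact ne_top_of_le_ne_top ENNReal.one_ne_top (PMF.toOuterMeasure_apply_le_one _ _)
  calc (a.history G' t).toOuterMeasure X
      ≤ (a.history G' t).toOuterMeasure (X ∩ {h | a.Clean hit h} ∪ {h | ¬ a.Clean hit h}) := by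
        refine MeasureTheory.measure_mono fun h hh => ?_
        by_cases hc : a.Clean hit h
        · exact Or.inl ⟨hh, hc⟩
        · exact Or.inr hc
    _ ≤ (a.history G' t).toOuterMeasure (X ∩ {h | a.Clean hit h}) +
          (a.history G' t).toOuterMeasure {h | ¬ a.Clean hit h} :=
        MeasureTheory.measure_union_le _ _
    _ ≤ _ := by
        rw [key _ Set.inter_subset_right, hcompl]
        gcongr
        exact Set.inter_subset_left

/-- If no number is a good estimate for both `G` and `G'`, then an algorithm succeeds on both only
as far as it distinguishes them. -/
theorem successProb_add_successProb_le {ε : ℝ} {hit : Query n → Prop}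
    (hhit : ∀ Q, ¬ hit Q → oracle G Q = oracle G' Q)
    (hdisj : ∀ x : ℝ, (1 - ε) * edgeCount G ≤ x → x ≤ (1 + ε) * edgeCount G →
      (1 - ε) * edgeCount G' ≤ x → x ≤ (1 + ε) * edgeCount G' → False) (τ : ℕ) :
    a.successProb G ε + a.successProb G' ε ≤
      1 + ((a.history G τ).toOuterMeasure {h | ¬ a.Clean hit h} +
        (a.history G' τ).toOuterMeasure a.running) := by
  set X : Set (List (Answer n)) :=
    {h | ∃ x : ℝ, a h = .inr x ∧ (1 - ε) * edgeCount G ≤ x ∧ x ≤ (1 + ε) * edgeCount G} with hX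
  set X' : Set (List (Answer n)) :=
    {h | ∃ x : ℝ, a h = .inr x ∧ (1 - ε) * edgeCount G' ≤ x ∧ x ≤ (1 + ε) * edgeCount G'} with hX'
  have hXr : Disjoint X a.running := by
    rw [Set.disjoint_left]
    rintro h ⟨x, hx, -⟩ ⟨Q, hQ⟩
    rw [hx] at hQ; cases hQ
  have hXr' : Disjoint X' a.running := by
    rw [Set.disjoint_left]
    rintro h ⟨x, hx, -⟩ ⟨Q, hQ⟩
    rw [hx] at hQ; cases hQ
  -- Runs on `G` unfinished at time `τ` may be counted as successes for free, since they are
  -- disjoint from `X'`; only unfinished runs on `G'` enter the bound.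
  have hXX' : Disjoint (X ∪ a.running) X' := by
    rw [Set.disjoint_union_left]
    refine ⟨Set.disjoint_left.2 ?_, hXr'.symm⟩
    rintro h ⟨x, hx, h1, h2⟩ ⟨y, hy, h3, h4⟩
    rw [hx] at hy
    cases hy
    exact hdisj x h1 h2 h3 h4
  calc a.successProb G ε + a.successProb G' ε
      ≤ (a.history G τ).toOuterMeasure (X ∪ a.running) +
          (a.history G' τ).toOuterMeasure (X' ∪ a.running) :=
        add_le_add (iSup_history_le a G hXr τ) (iSup_history_le a G' hXr' τ)
    _ ≤ (a.history G τ).toOuterMeasure (X ∪ a.running) +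
          ((a.history G τ).toOuterMeasure X' +
            (a.history G τ).toOuterMeasure {h | ¬ a.Clean hit h} +
            (a.history G' τ).toOuterMeasure a.running) := by
        gcongr
        refine (MeasureTheory.measure_union_le _ _).trans ?_
        gcongr
        exact history_le_add_not_clean a hhit τ X'
    _ = (a.history G τ).toOuterMeasure (X ∪ a.running ∪ X') +
          ((a.history G τ).toOuterMeasure {h | ¬ a.Clean hit h} +
            (a.history G' τ).toOuterMeasure a.running) := by
        rw [PMF.toOuterMeasure_union_of_disjoint _ hXX']
        ring
    _ ≤ _ := by
        gcongr
        exact PMF.toOuterMeasure_apply_le_one _ _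

end DetAlgorithm

/-! ### Measurability in the internal randomness. -/

variable {n : ℕ}

/-- Makes the set of histories countable, so that sums over histories stay measurable. -/
instance : Countable (Answer n) := by
  let f : Answer n → ℕ ⊕ Option (Fin n) ⊕ Bool := fun x => match x with
    | .degree d => .inl d
    | .neighbor u => .inr (.inl u)
    | .indepSet b => .inr (.inr b)
  have hf : Function.Injective f := by
    rintro (_ | _ | _) (_ | _ | _) h <;> simp_all [f]
  exact hf.countable

namespace RandAlgorithm

variable {Ω : Type*} [MeasurableSpace Ω] (A : RandAlgorithm n Ω) (G : SimpleGraph (Fin n))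

theorem measurable_step (h l : List (Answer n)) :
    Measurable fun ω => (A.next ω).step G h l := by
  have hg : Measurable (Sum.elim (fun Q => ((oracle G Q).map fun x => x :: h) l)
      (fun _ => PMF.pure h l) : Query n ⊕ ℝ → ℝ≥0∞) :=
    measurable_from_top.sumElim measurable_const
  convert hg.comp (A.measurable_next h) using 2 with ω
  simp only [DetAlgorithm.step, Function.comp]
  rcases A.next ω h with Q | x <;> rfl

theorem measurable_history (t : ℕ) (l : List (Answer n)) :
    Measurable fun ω => (A.next ω).history G t l := by
  induction t generalizing l with
  | zero => exact measurable_const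
  | succ t ih =>
    simp only [DetAlgorithm.history_succ, PMF.bind_apply]
    exact Measurable.tsum fun h => (ih h).mul (A.measurable_step G h l)

theorem measurable_expectedQueries : Measurable fun ω => (A.next ω).expectedQueries G := by
  simp only [DetAlgorithm.expectedQueries, PMF.toOuterMeasure_apply]
  refine Measurable.tsum fun t => Measurable.tsum fun h => ?_
  have hg : Measurable (Sum.elim (fun _ => 1) (fun _ => 0) : Query n ⊕ ℝ → ℝ≥0∞) :=
    measurable_const.sumElim measurable_const
  convert (hg.comp (A.measurable_next h)).mul (A.measurable_history G t h) using 2 with ω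
  simp only [Set.indicator, Set.mem_ofPred_eq, Function.comp, Pi.mul_apply]
  obtain ⟨z, hz⟩ : ∃ z, A.next ω h = z := ⟨_, rfl⟩
  rcases z with Q | x <;> simp [hz]

end RandAlgorithm

/-! ### Random renaming and averaging over permutations. -/

/-- The graph `H` with its vertices renamed by `π`. -/
def permute (π : Equiv.Perm (Fin n)) (H : SimpleGraph (Fin n)) : SimpleGraph (Fin n) :=
  H.comap π.symm

@[simp]
theorem permute_adj {π : Equiv.Perm (Fin n)} {H : SimpleGraph (Fin n)} {u v : Fin n} :
    (permute π H).Adj u v ↔ H.Adj (π.symm u) (π.symm v) := Iff.rfl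

theorem permute_mul (π σ : Equiv.Perm (Fin n)) (H : SimpleGraph (Fin n)) :
    permute (π * σ) H = permute π (permute σ H) := rfl

/-- Twins may be exchanged; whether they are adjacent to each other plays no role. -/
theorem permute_swap_eq_self {H : SimpleGraph (Fin n)} {i j : Fin n}
    (h : ∀ u, u ≠ i → u ≠ j → (H.Adj i u ↔ H.Adj j u)) : permute (Equiv.swap i j) H = H := by
  ext u v
  rw [permute_adj, Equiv.symm_swap]
  have key : ∀ v, v ≠ i → v ≠ j → ∀ u, H.Adj (Equiv.swap i j u) v ↔ H.Adj u v := by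
    intro v hvi hvj u
    rw [Equiv.swap_apply_def]
    split_ifs with hui huj
    · rw [hui, h v hvi hvj]
    · rw [huj, h v hvi hvj]
    · rfl
  by_cases hv : v ≠ i ∧ v ≠ j
  · rw [Equiv.swap_apply_of_ne_of_ne hv.1 hv.2]
    exact key v hv.1 hv.2 u
  by_cases hu : u ≠ i ∧ u ≠ j
  · rw [Equiv.swap_apply_of_ne_of_ne hu.1 hu.2, H.adj_comm, H.adj_comm u]
    exact key u hu.1 hu.2 v
  have hu' : u = i ∨ u = j := by tauto
  have hv' : v = i ∨ v = j := by tauto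
  rcases hu' with rfl | rfl <;> rcases hv' with rfl | rfl <;> simp [H.adj_comm]

theorem edgeCount_permute (π : Equiv.Perm (Fin n)) (H : SimpleGraph (Fin n)) :
    edgeCount (permute π H) = edgeCount H := by
  have e : permute π H ≃g H := ⟨π.symm, Iff.rfl⟩
  unfold edgeCount
  rw [← Nat.card_coe_set_eq, ← Nat.card_coe_set_eq]
  exact Nat.card_congr e.mapEdgeSet

/-- If a deterministic algorithm does badly on average over the renamings of two graphs, then a
randomized algorithm does badly on one of these renamings. -/
theorem exists_permute_successProb_le {H H' : SimpleGraph (Fin n)} {ε : ℝ} {ρ ρ' : ℝ≥0∞}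
    (hsum : ∀ a : DetAlgorithm n,
      ∑ π, (a.successProb (permute π H) ε + a.successProb (permute π H') ε) ≤
        ∑ π, (1 + (ρ * a.expectedQueries (permute π H) + ρ' * a.expectedQueries (permute π H'))))
    {Ω : Type*} [MeasurableSpace Ω] (P : MeasureTheory.Measure Ω)
    [MeasureTheory.IsProbabilityMeasure P] (A : RandAlgorithm n Ω) :
    (∃ π, A.successProb P (permute π H) ε ≤ 1 / 2 + ρ * A.expectedQueries P (permute π H)) ∨
    (∃ π, A.successProb P (permute π H') ε ≤ 1 / 2 + ρ' * A.expectedQueries P (permute π H')) := by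
  by_contra! hcon
  obtain ⟨h1, h2⟩ := hcon
  have hlt : ∑ π, ((1 / 2 + ρ * A.expectedQueries P (permute π H)) +
      (1 / 2 + ρ' * A.expectedQueries P (permute π H'))) <
      ∑ π, (A.successProb P (permute π H) ε + A.successProb P (permute π H') ε) :=
    ENNReal.sum_lt_sum_of_nonempty Finset.univ_nonempty
      fun π _ => ENNReal.add_lt_add (h1 π) (h2 π)
  refine absurd hlt (not_lt.2 ?_)
  have hm := fun G => A.measurable_expectedQueries G
  -- The lower integral is superadditive without measurability, so success probabilities need no
  -- measurability proof; only the expected query counts do.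
  have lintegral_sum_ge : ∀ (s : Finset (Equiv.Perm (Fin n)))
      (f : Equiv.Perm (Fin n) → Ω → ℝ≥0∞),
      ∑ π ∈ s, ∫⁻ ω, f π ω ∂P ≤ ∫⁻ ω, ∑ π ∈ s, f π ω ∂P := by
    intro s f
    induction s using Finset.cons_induction with
    | empty => simp
    | cons π s hπ ih =>
      simp only [Finset.sum_cons]
      exact (add_le_add_right ih _).trans (MeasureTheory.le_lintegral_add _ _)
  calc ∑ π, (A.successProb P (permute π H) ε + A.successProb P (permute π H') ε)
      ≤ ∑ π, ∫⁻ ω, ((A.next ω).successProb (permute π H) ε +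
          (A.next ω).successProb (permute π H') ε) ∂P :=
        Finset.sum_le_sum fun π _ => MeasureTheory.le_lintegral_add _ _
    _ ≤ ∫⁻ ω, ∑ π, ((A.next ω).successProb (permute π H) ε +
          (A.next ω).successProb (permute π H') ε) ∂P := lintegral_sum_ge _ _
    _ ≤ ∫⁻ ω, ∑ π, (1 + (ρ * (A.next ω).expectedQueries (permute π H) +
          ρ' * (A.next ω).expectedQueries (permute π H'))) ∂P :=
        MeasureTheory.lintegral_mono fun ω => hsum (A.next ω)
    _ = ∑ π, (1 + (ρ * A.expectedQueries P (permute π H) +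
          ρ' * A.expectedQueries P (permute π H'))) := by
        rw [MeasureTheory.lintegral_finsetSum]
        · refine Finset.sum_congr rfl fun π _ => ?_
          rw [MeasureTheory.lintegral_add_left measurable_const, MeasureTheory.lintegral_const,
            MeasureTheory.measure_univ, mul_one,
            MeasureTheory.lintegral_add_left ((hm _).const_mul _),
            MeasureTheory.lintegral_const_mul _ (hm _), MeasureTheory.lintegral_const_mul _ (hm _)]
          rfl
        · exact fun π _ => measurable_const.add (((hm _).const_mul _).add ((hm _).const_mul _))
    _ = _ := by
        refine Finset.sum_congr rfl fun π _ => ?_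
        rw [add_add_add_comm, ENNReal.add_halves]

theorem permute_mul_swap_of_twins {H : SimpleGraph (Fin n)} {i j : Fin n}
    (h : permute (Equiv.swap i j) H = H) (π : Equiv.Perm (Fin n)) :
    permute (π * Equiv.swap i j) H = permute π H := by
  rw [permute_mul, h]

open Classical in
/-- A vertex of the renamed graph which depends only on that graph is equally likely to have each
of the labels from a set of interchangeable vertices. -/
theorem card_mul_sum_permute_le {H : SimpleGraph (Fin n)} {B C : Finset (Fin n)}
    (hC : ∀ i ∈ C, ∀ j ∈ C, permute (Equiv.swap i j) H = H) (hBC : B ⊆ C)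
    (F : SimpleGraph (Fin n) → ℝ≥0∞) (v : SimpleGraph (Fin n) → Option (Fin n)) :
    (C.card : ℝ≥0∞) *
        ∑ π, (if ∃ b ∈ B, v (permute π H) = some (π b) then F (permute π H) else 0) ≤
      B.card * ∑ π, F (permute π H) := by
  set f : Fin n → ℝ≥0∞ :=
    fun b => ∑ π : Equiv.Perm (Fin n), if v (permute π H) = some (π b) then F (permute π H) else 0
    with hf
  -- The substitution `π ↦ π * swap b c` leaves the renamed graph unchanged and turns the label `π
  -- b` into `π c`.
  have hswap : ∀ b ∈ C, ∀ c ∈ C, f b = f c := by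
    intro b hb c hc
    simp only [hf]
    refine Fintype.sum_equiv (Equiv.mulRight (Equiv.swap b c)) _ _ fun π => ?_
    simp [permute_mul_swap_of_twins (hC b hb c hc)]
  have hle : ∀ b ∈ C, (C.card : ℝ≥0∞) * f b ≤ ∑ π, F (permute π H) := by
    intro b hb
    calc (C.card : ℝ≥0∞) * f b = ∑ c ∈ C, f c := by
          rw [Finset.sum_congr rfl fun c hc => (hswap b hb c hc).symm, Finset.sum_const,
            nsmul_eq_mul]
      _ = ∑ π, ∑ c ∈ C, if v (permute π H) = some (π c) then F (permute π H) else 0 :=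
          Finset.sum_comm
      _ ≤ ∑ π, F (permute π H) := by
          refine Finset.sum_le_sum fun π _ => ?_
          rw [← Finset.sum_filter, Finset.sum_const, nsmul_eq_mul]
          refine mul_le_of_le_one_left zero_le ?_
          have : (C.filter fun c => v (permute π H) = some (π c)).card ≤ 1 := by
            refine Finset.card_le_one.2 fun x hx y hy => ?_
            have hx' := (Finset.mem_filter.1 hx).2
            rw [(Finset.mem_filter.1 hy).2] at hx'
            exact (π.injective (Option.some.inj hx')).symm
          exact_mod_cast this
  calc (C.card : ℝ≥0∞) *
        ∑ π, (if ∃ b ∈ B, v (permute π H) = some (π b) then F (permute π H) else 0)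
      ≤ C.card * ∑ b ∈ B, f b := by
        rw [Finset.sum_comm]
        gcongr with π
        split_ifs with h
        · obtain ⟨b, hb, hv⟩ := h
          refine le_trans ?_ (Finset.single_le_sum (fun _ _ => zero_le) hb)
          rw [if_pos hv]
        · exact zero_le
    _ = ∑ b ∈ B, C.card * f b := Finset.mul_sum _ _ _
    _ ≤ ∑ b ∈ B, ∑ π, F (permute π H) := Finset.sum_le_sum fun b hb => hle b (hBC hb)
    _ = _ := by rw [Finset.sum_const, nsmul_eq_mul]

open Classical in
theorem sum_toOuterMeasure_eq_tsum {ι : Type*} (s : Finset ι) {α : Type*} (p : ι → PMF α)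
    (X : ι → Set α) :
    ∑ i ∈ s, (p i).toOuterMeasure (X i) = ∑' x, ∑ i ∈ s, if x ∈ X i then p i x else 0 := by
  simp only [PMF.toOuterMeasure_apply, Set.indicator]
  exact (Summable.tsum_finsetSum fun _ _ => ENNReal.summable).symm

/-- `card_mul_sum_permute_le` for each single history, weighted by its probability. The vertex `v`
may depend on the renamed graph and on the history, but not otherwise on `π`. -/
theorem card_mul_sum_history_permute_le (a : DetAlgorithm n) {H : SimpleGraph (Fin n)}
    {B C : Finset (Fin n)} (hC : ∀ i ∈ C, ∀ j ∈ C, permute (Equiv.swap i j) H = H) (hBC : B ⊆ C)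
    (t : ℕ) (Y : Set (List (Answer n)))
    (v : SimpleGraph (Fin n) → List (Answer n) → Option (Fin n)) :
    (C.card : ℝ≥0∞) * ∑ π, (a.history (permute π H) t).toOuterMeasure
        {h | h ∈ Y ∧ ∃ b ∈ B, v (permute π H) h = some (π b)} ≤
      B.card * ∑ π, (a.history (permute π H) t).toOuterMeasure Y := by
  classical
  rw [sum_toOuterMeasure_eq_tsum, sum_toOuterMeasure_eq_tsum, ← ENNReal.tsum_mul_left,
    ← ENNReal.tsum_mul_left]
  refine ENNReal.tsum_le_tsum fun h => ?_
  by_cases hY : h ∈ Y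
  · simpa [hY] using card_mul_sum_permute_le hC hBC (fun G => a.history G t h) (fun G => v G h)
  · simp [hY]

/-! ### Graphs with equal oracle answers. -/

section Oracle

variable {G G' : SimpleGraph (Fin n)}

theorem oracle_degree_congr {v : Fin n} (h : ∀ u, G.Adj v u ↔ G'.Adj v u) :
    oracle G (.degree v) = oracle G' (.degree v) := by
  classical
  have e : G.neighborFinset v = G'.neighborFinset v := by ext u; simp [h]
  simp only [oracle, ← SimpleGraph.card_neighborFinset_eq_degree]
  congr! 3

theorem oracle_neighbor_congr {v : Fin n} (h : ∀ u, G.Adj v u ↔ G'.Adj v u) :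
    oracle G (.neighbor v) = oracle G' (.neighbor v) := by
  classical
  have e : G.neighborFinset v = G'.neighborFinset v := by ext u; simp [h]
  have key : ∀ s t : Finset (Fin n), s = t →
      (if h : s.Nonempty then (PMF.uniformOfFinset s h).map fun u => Answer.neighbor (some u)
        else PMF.pure (.neighbor none)) =
      (if h : t.Nonempty then (PMF.uniformOfFinset t h).map fun u => Answer.neighbor (some u)
        else PMF.pure (.neighbor none)) := by
    rintro s _ rfl; rfl
  simp only [oracle]
  apply key
  convert e

theorem oracle_indepSet_congr {S : Finset (Fin n)}
    (h : G.IsIndepSet (S : Set (Fin n)) ↔ G'.IsIndepSet (S : Set (Fin n))) :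
    oracle G (.indepSet S) = oracle G' (.indepSet S) := by
  simp only [oracle]
  rw [decide_eq_decide.2 h]

open Classical in
theorem oracle_neighbor_apply_some (v u : Fin n) :
    oracle G (.neighbor v) (.neighbor (some u)) =
      if G.Adj v u then ((G.degree v : ℕ) : ℝ≥0∞)⁻¹ else 0 := by
  simp only [oracle]
  split_ifs with h1 h2 h2
  · have hinj : Function.Injective fun u : Fin n => Answer.neighbor (some u) :=
      fun _ _ h => by simpa using h
    have := (PMF.uniformOfFinset (G.neighborFinset v) h1).map_apply_of_injective hinj u
    rw [this, PMF.uniformOfFinset_apply, if_pos (by simpa using h2)]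
    rfl
  · have hinj : Function.Injective fun u : Fin n => Answer.neighbor (some u) :=
      fun _ _ h => by simpa using h
    have := (PMF.uniformOfFinset (G.neighborFinset v) h1).map_apply_of_injective hinj u
    rw [this, PMF.uniformOfFinset_apply, if_neg (by simpa using h2)]
  · exact (h1 ⟨u, by simpa using h2⟩).elim
  · simp [PMF.pure_apply]

open Classical in
theorem oracle_neighbor_apply_none (v : Fin n) :
    oracle G (.neighbor v) (.neighbor none) = if G.degree v = 0 then 1 else 0 := by
  simp only [oracle, ← SimpleGraph.card_neighborFinset_eq_degree, Finset.card_eq_zero]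
  split_ifs with h1 h2 h2
  · exact (h1.ne_empty h2).elim
  · simp [PMF.map_apply]
  · simp [PMF.pure_apply]
  · exact (h1 (Finset.nonempty_iff_ne_empty.2 h2)).elim

theorem oracle_neighbor_apply_of_ne {v : Fin n} {x : Answer n} (hx : ∀ u, x ≠ .neighbor u) :
    oracle G (.neighbor v) x = 0 := by
  simp only [oracle]
  split_ifs with h1
  · simp [PMF.map_apply, hx]
  · simp [PMF.pure_apply, hx]

end Oracle

/-! ### Sequential reading of independent-set queries. -/

section Touched

open Classical in
/-- The vertices that have to be inspected one after the other to answer the query: those of an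
independent-set query are inspected in increasing order until an edge has been found. -/
noncomputable def touched (G : SimpleGraph (Fin n)) : Query n → Finset (Fin n)
  | .degree v => {v}
  | .neighbor v => {v}
  | .indepSet S => S.filter fun y => G.IsIndepSet {z | z ∈ S ∧ z < y}

/-- The vertices whose role in the graph is revealed by a query and its answer. -/
noncomputable def revealed (G : SimpleGraph (Fin n)) : Query n → Answer n → Finset (Fin n)
  | .neighbor v, .neighbor (some u) => {v, u}
  | Q, _ => touched G Q

variable {G : SimpleGraph (Fin n)}

theorem touched_subset_revealed (Q : Query n) (x : Answer n) : touched G Q ⊆ revealed G Q x := by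
  unfold revealed
  split
  · simp [touched]
  · exact subset_rfl

theorem mem_touched_indepSet {S : Finset (Fin n)} {y : Fin n} :
    y ∈ touched G (.indepSet S) ↔ y ∈ S ∧ G.IsIndepSet {z | z ∈ S ∧ z < y} := by
  simp [touched]

theorem touched_indepSet_of_isIndepSet {S : Finset (Fin n)}
    (h : G.IsIndepSet (S : Set (Fin n))) : touched G (.indepSet S) = S := by
  ext y
  rw [mem_touched_indepSet]
  exact ⟨fun hy => hy.1, fun hy => ⟨hy, h.mono fun z hz => hz.1⟩⟩

/-- Take the least vertex of `S` that has a smaller neighbor in `S`: the part of `S` before it is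
independent, so both ends of that edge are read. -/
theorem exists_adj_touched_of_not_isIndepSet {S : Finset (Fin n)}
    (h : ¬ G.IsIndepSet (S : Set (Fin n))) :
    ∃ u ∈ touched G (.indepSet S), ∃ v ∈ touched G (.indepSet S), G.Adj u v := by
  classical
  have edge : ∀ {s : Set (Fin n)}, ¬ G.IsIndepSet s → ∃ u ∈ s, ∃ v ∈ s, u < v ∧ G.Adj u v := by
    intro s hs
    simp only [SimpleGraph.IsIndepSet, Set.Pairwise, not_forall, not_not] at hs
    obtain ⟨u, hu, v, hv, huv, hadj⟩ := hs
    rcases lt_or_gt_of_ne huv with hlt | hlt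
    · exact ⟨u, hu, v, hv, hlt, hadj⟩
    · exact ⟨v, hv, u, hu, hlt, hadj.symm⟩
  set M : Finset (Fin n) := S.filter fun v => ∃ u ∈ S, u < v ∧ G.Adj u v with hM
  have hne : M.Nonempty := by
    obtain ⟨u, hu, v, hv, hlt, hadj⟩ := edge h
    exact ⟨v, Finset.mem_filter.2 ⟨hv, u, hu, hlt, hadj⟩⟩
  obtain ⟨hvS, u, huS, hlt, hadj⟩ := Finset.mem_filter.1 (M.min'_mem hne)
  set v := M.min' hne
  have hv : G.IsIndepSet {z | z ∈ S ∧ z < v} := by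
    by_contra hcon
    obtain ⟨x, hx, y, hy, hxy, hadj'⟩ := edge hcon
    have : y ∈ M := Finset.mem_filter.2 ⟨hy.1, x, hx.1, hxy, hadj'⟩
    exact absurd (M.min'_le y this) (not_le.2 hy.2)
  refine ⟨u, mem_touched_indepSet.2 ⟨huS, ?_⟩, v, mem_touched_indepSet.2 ⟨hvS, hv⟩, hadj⟩
  exact fun p hp q hq hpq => hv ⟨hp.1, hp.2.trans hlt⟩ ⟨hq.1, hq.2.trans hlt⟩ hpq

/-- Everything in `M` below its maximum lies in an independent set, hence is at most one vertex of a
clique. -/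
theorem card_le_two_of_subset_touched {S M : Finset (Fin n)} (hM : M ⊆ touched G (.indepSet S))
    (hclique : ∀ u ∈ M, ∀ v ∈ M, u ≠ v → G.Adj u v) : M.card ≤ 2 := by
  rcases M.eq_empty_or_nonempty with rfl | hne
  · simp
  · have hy := M.max'_mem hne
    rw [← Finset.card_erase_add_one hy]
    suffices (M.erase (M.max' hne)).card ≤ 1 by omega
    refine Finset.card_le_one.2 fun u hu v hv => ?_
    by_contra huv
    have hmem : ∀ z ∈ M.erase (M.max' hne), z ∈ {z | z ∈ S ∧ z < M.max' hne} := by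
      intro z hz
      exact ⟨(mem_touched_indepSet.1 (hM (Finset.mem_of_mem_erase hz))).1,
        M.lt_max'_of_mem_erase_max' hne hz⟩
    exact (mem_touched_indepSet.1 (hM hy)).2 (hmem u hu) (hmem v hv) huv
      (hclique u (Finset.mem_of_mem_erase hu) v (Finset.mem_of_mem_erase hv) huv)

theorem card_le_two_of_subset_revealed {Q : Query n} {x : Answer n} {M : Finset (Fin n)}
    (hM : M ⊆ revealed G Q x) (hclique : ∀ u ∈ M, ∀ v ∈ M, u ≠ v → G.Adj u v) : M.card ≤ 2 := by
  unfold revealed at hM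
  split at hM
  · exact (Finset.card_le_card hM).trans Finset.card_le_two
  · rcases Q with v | v | S
    · exact (Finset.card_le_card hM).trans (by simp [touched])
    · exact (Finset.card_le_card hM).trans (by simp [touched])
    · exact card_le_two_of_subset_touched hM hclique

end Touched

/-! ### Exchanging two vertices that were not revealed. -/

section Swap

variable {G : SimpleGraph (Fin n)} {x y : Fin n}

theorem permute_swap_adj {u v : Fin n} (hux : u ≠ x) (huy : u ≠ y) (hvx : v ≠ x) (hvy : v ≠ y) :
    (permute (Equiv.swap x y) G).Adj u v ↔ G.Adj u v := by
  rw [permute_adj, Equiv.symm_swap, Equiv.swap_apply_of_ne_of_ne hux huy,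
    Equiv.swap_apply_of_ne_of_ne hvx hvy]

open Classical in
theorem degree_permute_swap {v : Fin n} (hvx : v ≠ x) (hvy : v ≠ y) :
    (permute (Equiv.swap x y) G).degree v = G.degree v := by
  have he : ∃ e : G ≃g permute (Equiv.swap x y) G, e v = v :=
    ⟨⟨Equiv.swap x y, by simp⟩, Equiv.swap_apply_of_ne_of_ne hvx hvy⟩
  obtain ⟨e, he⟩ := he
  conv_lhs => rw [← he]
  exact e.degree_eq v

/-- If `S` contains an edge, one between read vertices survives the exchange; if `S` is independent,
all of it is read, so it contains neither `x` nor `y`. -/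
theorem isIndepSet_permute_swap_iff {S : Finset (Fin n)} (hx : x ∉ touched G (.indepSet S))
    (hy : y ∉ touched G (.indepSet S)) :
    (permute (Equiv.swap x y) G).IsIndepSet (S : Set (Fin n)) ↔
      G.IsIndepSet (S : Set (Fin n)) := by
  constructor
  · intro h
    by_contra hcon
    obtain ⟨u, hu, v, hv, hadj⟩ := exists_adj_touched_of_not_isIndepSet hcon
    refine h (mem_touched_indepSet.1 hu).1 (mem_touched_indepSet.1 hv).1 hadj.ne ?_
    rw [permute_swap_adj]
    · exact hadj
    all_goals rintro rfl; contradiction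
  · intro h
    rw [touched_indepSet_of_isIndepSet h] at hx hy
    intro u hu v hv huv
    rw [permute_swap_adj]
    · exact h hu hv huv
    all_goals rintro rfl; contradiction

/-- Equality holds only for the single answer `z`, because a neighbor answer itself reveals a
vertex. -/
theorem oracle_permute_swap_apply {Q : Query n} {z : Answer n} (hx : x ∉ revealed G Q z)
    (hy : y ∉ revealed G Q z) :
    oracle (permute (Equiv.swap x y) G) Q z = oracle G Q z := by
  classical
  have hx' := fun h => hx (touched_subset_revealed Q z h)
  have hy' := fun h => hy (touched_subset_revealed Q z h)
  rcases Q with v | v | S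
  · simp only [touched, Finset.mem_singleton] at hx' hy'
    simp only [oracle]
    rw [degree_permute_swap (Ne.symm hx') (Ne.symm hy')]
  · simp only [touched, Finset.mem_singleton] at hx' hy'
    have hdeg := degree_permute_swap (G := G) (Ne.symm hx') (Ne.symm hy')
    rcases z with d | (_ | u) | b
    · rw [oracle_neighbor_apply_of_ne (by simp), oracle_neighbor_apply_of_ne (by simp)]
    · rw [oracle_neighbor_apply_none, oracle_neighbor_apply_none, hdeg]
    · simp only [revealed, Finset.mem_insert, Finset.mem_singleton, not_or] at hx hy
      have hadj := permute_swap_adj (G := G) (Ne.symm hx') (Ne.symm hy') (Ne.symm hx.2)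
        (Ne.symm hy.2)
      rw [oracle_neighbor_apply_some, oracle_neighbor_apply_some, hdeg]
      by_cases h : G.Adj v u
      · rw [if_pos h, if_pos (hadj.2 h)]
      · rw [if_neg h, if_neg fun h' => h (hadj.1 h')]
    · rw [oracle_neighbor_apply_of_ne (by simp), oracle_neighbor_apply_of_ne (by simp)]
  · rw [oracle_indepSet_congr (isIndepSet_permute_swap_iff hx' hy')]

/-- Exchanging an isolated vertex `y` that is inspected with another vertex leaves the position of
`y` among the inspected vertices. -/
theorem mem_touched_permute_swap {S : Finset (Fin n)} (hiso : ∀ u, ¬ G.Adj y u)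
    (hy : y ∈ touched G (.indepSet S)) :
    y ∈ touched (permute (Equiv.swap y x) G) (.indepSet S) := by
  rw [mem_touched_indepSet] at hy ⊢
  refine ⟨hy.1, fun u hu v hv huv => ?_⟩
  change ¬ (permute (Equiv.swap y x) G).Adj u v
  -- Of the vertices of `S` before `y`, only `x` can change its role, and it becomes isolated, so
  -- they stay independent.
  by_cases hux : u = x
  · rw [hux, permute_adj, Equiv.symm_swap, Equiv.swap_apply_right]
    exact hiso _
  by_cases hvx : v = x
  · rw [hvx, SimpleGraph.adj_comm, permute_adj, Equiv.symm_swap, Equiv.swap_apply_right]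
    exact hiso _
  rw [permute_swap_adj hu.2.ne hux hv.2.ne hvx]
  exact hy.2 hu hv huv

end Swap

/-! ### Isolated vertices are hidden among the clique vertices. -/

namespace DetAlgorithm

variable (a : DetAlgorithm n)

/-- The vertices whose role is revealed by the queries and answers of a history. -/
noncomputable def revealedSet (G : SimpleGraph (Fin n)) : List (Answer n) → Finset (Fin n)
  | [] => ∅
  | x :: h => revealedSet G h ∪
      match a h with
      | .inl Q => revealed G Q x
      | .inr _ => ∅

variable {a} in
theorem revealedSet_cons {G : SimpleGraph (Fin n)} {x : Answer n} {h : List (Answer n)}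
    {Q : Query n} (hQ : a h = .inl Q) :
    a.revealedSet G (x :: h) = a.revealedSet G h ∪ revealed G Q x := by
  simp [revealedSet, hQ]

/-- Each query with its answer reveals at most two vertices of a clique. -/
theorem card_le_of_subset_revealedSet {G : SimpleGraph (Fin n)} {h : List (Answer n)}
    {M : Finset (Fin n)} (hM : M ⊆ a.revealedSet G h)
    (hclique : ∀ u ∈ M, ∀ v ∈ M, u ≠ v → G.Adj u v) : M.card ≤ 2 * h.length := by
  induction h generalizing M with
  | nil =>
    have : M = ∅ := Finset.subset_empty.1 hM
    simp [this]
  | cons x h ih =>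
    set N : Finset (Fin n) := match a h with
      | .inl Q => revealed G Q x
      | .inr _ => ∅ with hN
    have h1 : (M ∩ a.revealedSet G h).card ≤ 2 * h.length :=
      ih Finset.inter_subset_right fun u hu v hv =>
        hclique u (Finset.mem_inter.1 hu).1 v (Finset.mem_inter.1 hv).1
    have h2 : (M ∩ N).card ≤ 2 := by
      rcases hQ : a h with Q | r
      · simp only [hQ] at hN
        refine card_le_two_of_subset_revealed (Q := Q) (x := x)
          (by rw [hN]; exact Finset.inter_subset_right) fun u hu v hv =>
          hclique u (Finset.mem_inter.1 hu).1 v (Finset.mem_inter.1 hv).1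
      · simp only [hQ] at hN
        simp [hN]
    have h3 : M = (M ∩ a.revealedSet G h) ∪ (M ∩ N) := by
      rw [← Finset.inter_union_distrib_left]
      exact (Finset.inter_eq_left.2 hM).symm
    rw [h3]
    refine (Finset.card_union_le _ _).trans ?_
    rw [List.length_cons]
    omega

theorem history_permute_swap_apply {G : SimpleGraph (Fin n)} {x y : Fin n} (t : ℕ)
    {h : List (Answer n)} (hx : x ∉ a.revealedSet G h) (hy : y ∉ a.revealedSet G h) :
    a.history (permute (Equiv.swap x y) G) t h = a.history G t h := by
  refine (history_apply_eq a G _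
    (good := fun h => x ∉ a.revealedSet G h ∧ y ∉ a.revealedSet G h) ?_ t ⟨hx, hy⟩).symm
  rintro z h Q ⟨h1, h2⟩ hQ
  rw [revealedSet_cons hQ, Finset.mem_union, not_or] at h1 h2
  exact ⟨⟨h1.1, h2.1⟩, (oracle_permute_swap_apply h1.2 h2.2).symm⟩

/-- The histories after which the next query is an independent-set query. -/
def askingIndepSet : Set (List (Answer n)) := {h | ∃ S, a h = .inl (.indepSet S)}

/-- The histories after which the next query is a degree or a neighbor query. -/
def askingLocal : Set (List (Answer n)) :=
  {h | ∃ v, a h = .inl (.degree v) ∨ a h = .inl (.neighbor v)}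

theorem disjoint_askingIndepSet_askingLocal : Disjoint a.askingIndepSet a.askingLocal := by
  rw [Set.disjoint_left]
  rintro h ⟨S, hS⟩ ⟨v, hv | hv⟩ <;> rw [hS] at hv <;> cases hv

theorem askingIndepSet_union_askingLocal : a.askingIndepSet ∪ a.askingLocal = a.running := by
  ext h
  constructor
  · rintro (⟨S, hS⟩ | ⟨v, hv | hv⟩)
    exacts [⟨_, hS⟩, ⟨_, hv⟩, ⟨_, hv⟩]
  · rintro ⟨v | v | S, hQ⟩
    exacts [Or.inr ⟨v, Or.inl hQ⟩, Or.inr ⟨v, Or.inr hQ⟩, Or.inl ⟨S, hQ⟩]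

/-- An isolated vertex is rarely the newly inspected one, as most vertices of the clique could take
its place. -/
theorem mul_sum_history_touched_le {H : SimpleGraph (Fin n)} {C : Finset (Fin n)} {j : Fin n}
    (hclique : ∀ u ∈ C, ∀ v ∈ C, u ≠ v → H.Adj u v) (hiso : ∀ u, ¬ H.Adj j u) (t : ℕ) :
    ((C.card - 2 * t : ℕ) : ℝ≥0∞) * ∑ π, (a.history (permute π H) t).toOuterMeasure
        {h | ∃ S, a h = .inl (.indepSet S) ∧ π j ∈ touched (permute π H) (.indepSet S) ∧
          π j ∉ a.revealedSet (permute π H) h} ≤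
      2 * ∑ π, (a.history (permute π H) t).toOuterMeasure a.askingIndepSet := by
  classical
  rw [sum_toOuterMeasure_eq_tsum, sum_toOuterMeasure_eq_tsum, ← ENNReal.tsum_mul_left,
    ← ENNReal.tsum_mul_left]
  refine ENNReal.tsum_le_tsum fun h => ?_
  by_cases hS : ∃ S, a h = .inl (.indepSet S)
  swap
  · have : ∀ π : Equiv.Perm (Fin n), h ∉ {h | ∃ S, a h = .inl (.indepSet S) ∧
        π j ∈ touched (permute π H) (.indepSet S) ∧ π j ∉ a.revealedSet (permute π H) h} :=
      fun π ⟨S, hS', _⟩ => hS ⟨S, hS'⟩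
    simp [this]
  have hmem : h ∈ a.askingIndepSet := hS
  obtain ⟨S, hS⟩ := hS
  set g : Equiv.Perm (Fin n) → ℝ≥0∞ := fun π => a.history (permute π H) t h with hg
  have himg : ∀ (π : Equiv.Perm (Fin n)) (M : Finset (Fin n)), M ⊆ C →
      ∀ u ∈ M.map π.toEmbedding, ∀ v ∈ M.map π.toEmbedding, u ≠ v → (permute π H).Adj u v := by
    intro π M hM u hu v hv huv
    obtain ⟨u', hu', rfl⟩ := Finset.mem_map.1 hu
    obtain ⟨v', hv', rfl⟩ := Finset.mem_map.1 hv
    simp only [Equiv.coe_toEmbedding, permute_adj, Equiv.symm_apply_apply]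
    exact hclique u' (hM hu') v' (hM hv') fun e => huv (by rw [e])
  -- Double counting: each renaming on the left is charged to every clique vertex `c` not yet
  -- revealed, of which there are at least `C.card - 2 * t`.
  calc _ ≤ ∑ π, ∑ c ∈ C, if π j ∈ touched (permute π H) (.indepSet S) ∧
          π j ∉ a.revealedSet (permute π H) h ∧ π c ∉ a.revealedSet (permute π H) h
          then g π else 0 := by
        rw [Finset.mul_sum]
        refine Finset.sum_le_sum fun π _ => ?_
        split_ifs with hE
        swap
        · simp
        obtain ⟨S', hS', h1, h2⟩ := hE
        obtain rfl : S = S' := by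
          have := hS.symm.trans hS'
          simpa using this
        simp only [h1, h2, not_false_eq_true, true_and]
        rw [← Finset.sum_filter, Finset.sum_const, nsmul_eq_mul]
        -- The bound `h.length ≤ t` is available only for histories of positive probability.
        by_cases hg0 : g π = 0
        · exact (mul_eq_zero_of_right _ hg0).trans_le zero_le
        change _ * g π ≤ _
        gcongr
        have hlen : h.length ≤ t := length_le_of_history_ne_zero a _ hg0
        have hcard := card_le_of_subset_revealedSet a (G := permute π H) (h := h)
          (M := (C.filter fun c => π c ∈ a.revealedSet (permute π H) h).map π.toEmbedding) (by
            intro u hu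
            obtain ⟨u', hu', rfl⟩ := Finset.mem_map.1 hu
            exact (Finset.mem_filter.1 hu').2) (himg π _ (Finset.filter_subset _ _))
        rw [Finset.card_map] at hcard
        have := Finset.card_filter_add_card_filter_not (s := C)
          (fun c => π c ∈ a.revealedSet (permute π H) h)
        omega
    _ = ∑ c ∈ C, ∑ π, if π j ∈ touched (permute π H) (.indepSet S) ∧
          π j ∉ a.revealedSet (permute π H) h ∧ π c ∉ a.revealedSet (permute π H) h
          then g π else 0 := Finset.sum_comm
    _ ≤ ∑ c ∈ C, ∑ π, if π c ∈ touched (permute π H) (.indepSet S) then g π else 0 := by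
        refine Finset.sum_le_sum fun c _ => ?_
        -- Composing `π` with `swap j c` exchanges the labels `π j` and `π c`. Neither is revealed,
        -- so the history keeps its probability, and the label that was read now belongs to the
        -- clique vertex `c`.
        rw [← Equiv.sum_comp (Equiv.mulRight (Equiv.swap j c)) fun π : Equiv.Perm (Fin n) =>
          if π c ∈ touched (permute π H) (.indepSet S) then g π else 0]
        refine Finset.sum_le_sum fun π _ => ?_
        split_ifs with h1 h2 h2
        · obtain ⟨-, hj, hc⟩ := h1
          simp only [hg, Equiv.coe_mulRight]
          rw [Equiv.mul_swap_eq_swap_mul, permute_mul, history_permute_swap_apply a t hj hc]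
        · refine (h2 ?_).elim
          simp only [Equiv.coe_mulRight]
          have hj : (π * Equiv.swap j c) c = π j := by simp
          rw [hj, Equiv.mul_swap_eq_swap_mul, permute_mul]
          exact mem_touched_permute_swap (fun u => by simpa using hiso _) h1.1
        · exact zero_le
        · exact le_rfl
    _ = ∑ π, ∑ c ∈ C, if π c ∈ touched (permute π H) (.indepSet S) then g π else 0 :=
        Finset.sum_comm
    _ ≤ ∑ π, 2 * g π := by
        refine Finset.sum_le_sum fun π _ => ?_
        rw [← Finset.sum_filter, Finset.sum_const, nsmul_eq_mul]
        gcongr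
        have hcard := card_le_two_of_subset_touched (G := permute π H) (S := S)
          (M := (C.filter fun c => π c ∈ touched (permute π H) (.indepSet S)).map π.toEmbedding) (by
            intro u hu
            obtain ⟨u', hu', rfl⟩ := Finset.mem_map.1 hu
            exact (Finset.mem_filter.1 hu').2) (himg π _ (Finset.filter_subset _ _))
        rw [Finset.card_map] at hcard
        exact_mod_cast hcard
    _ = _ := by
        rw [← Finset.mul_sum]
        simp [hmem, hg]

end DetAlgorithm

/-! ### Hit probabilities for the two kinds of difference. -/

/-- No number is a `(1 ± ε)`-estimate of both `m` and `m'`. -/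
def NoCommonEstimate (ε : ℝ) (m m' : ℕ) : Prop :=
  ∀ x : ℝ, (1 - ε) * m ≤ x → x ≤ (1 + ε) * m → (1 - ε) * m' ≤ x → x ≤ (1 + ε) * m' → False

open Classical in
/-- A vertex at which the answer to the query depends on the graph: an independent-set query on a
set containing an edge is represented by an end of such an edge. -/
noncomputable def probe (G : SimpleGraph (Fin n)) : Query n → Option (Fin n)
  | .degree v => some v
  | .neighbor v => some v
  | .indepSet S => if h : ∃ u ∈ S, ∃ v ∈ S, G.Adj u v then some h.choose else none

namespace DetAlgorithm

variable (a : DetAlgorithm n)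

/-- The hit rate `p` is needed only on `H` and only before time `τ`; on `H'` just the chance of
outlasting `τ` queries is paid for, by Markov. -/
theorem sum_successProb_le {H H' : SimpleGraph (Fin n)} {ε : ℝ}
    (hdisj : NoCommonEstimate ε (edgeCount H) (edgeCount H'))
    {hit : Equiv.Perm (Fin n) → Query n → Prop}
    (hhit : ∀ π Q, ¬ hit π Q → oracle (permute π H) Q = oracle (permute π H') Q)
    {p : ℝ≥0∞} {τ : ℕ}
    (hp : ∀ t < τ, ∑ π, (a.history (permute π H) t).toOuterMeasure
        {h | a.Clean (hit π) h ∧ ∃ Q, a h = .inl Q ∧ hit π Q} ≤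
      p * ∑ π, (a.history (permute π H) t).toOuterMeasure a.running) :
    ∑ π, (a.successProb (permute π H) ε + a.successProb (permute π H') ε) ≤
      ∑ π, (1 + (p * a.expectedQueries (permute π H) +
        ((τ + 1 : ℕ) : ℝ≥0∞)⁻¹ * a.expectedQueries (permute π H'))) := by
  have h1 : ∑ π, (a.history (permute π H) τ).toOuterMeasure {h | ¬ a.Clean (hit π) h} ≤
      ∑ π, p * a.expectedQueries (permute π H) := by
    calc ∑ π, (a.history (permute π H) τ).toOuterMeasure {h | ¬ a.Clean (hit π) h}
        ≤ ∑ π, ∑ t ∈ Finset.range τ, (a.history (permute π H) t).toOuterMeasure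
            {h | a.Clean (hit π) h ∧ ∃ Q, a h = .inl Q ∧ hit π Q} :=
          Finset.sum_le_sum fun π _ => history_not_clean_le a _ _ τ
      _ = ∑ t ∈ Finset.range τ, ∑ π, (a.history (permute π H) t).toOuterMeasure
            {h | a.Clean (hit π) h ∧ ∃ Q, a h = .inl Q ∧ hit π Q} := Finset.sum_comm
      _ ≤ ∑ t ∈ Finset.range τ, p * ∑ π, (a.history (permute π H) t).toOuterMeasure a.running :=
          Finset.sum_le_sum fun t ht => hp t (Finset.mem_range.1 ht)
      _ = p * ∑ π, ∑ t ∈ Finset.range τ, (a.history (permute π H) t).toOuterMeasure a.running := by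
          rw [← Finset.mul_sum, Finset.sum_comm]
      _ ≤ _ := by
          rw [← Finset.mul_sum]
          gcongr with π
          exact sum_history_running_le a _ τ
  have h2 : ∀ π : Equiv.Perm (Fin n), (a.history (permute π H') τ).toOuterMeasure a.running ≤
      ((τ + 1 : ℕ) : ℝ≥0∞)⁻¹ * a.expectedQueries (permute π H') := by
    intro π
    rw [mul_comm, ← div_eq_mul_inv, ENNReal.le_div_iff_mul_le (Or.inl (by simp))
      (Or.inl (ENNReal.natCast_ne_top _)), mul_comm]
    exact mul_history_running_le a _ τ
  calc ∑ π, (a.successProb (permute π H) ε + a.successProb (permute π H') ε)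
      ≤ ∑ π, (1 + ((a.history (permute π H) τ).toOuterMeasure {h | ¬ a.Clean (hit π) h} +
          (a.history (permute π H') τ).toOuterMeasure a.running)) := by
        refine Finset.sum_le_sum fun π _ => successProb_add_successProb_le a _ _ (hhit π) ?_ τ
        rw [edgeCount_permute, edgeCount_permute]
        exact hdisj
    _ ≤ _ := by
        simp only [Finset.sum_add_distrib]
        gcongr with π
        exact h2 π

/-- The case of an added bipartite graph between the sets `W` and `D` of isolated vertices, in the
presence of the clique `C`. -/
theorem sum_successProb_le_of_clique {H H' : SimpleGraph (Fin n)} {ε : ℝ}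
    (hdisj : NoCommonEstimate ε (edgeCount H) (edgeCount H'))
    {C I W D : Finset (Fin n)} (hclique : ∀ u ∈ C, ∀ v ∈ C, u ≠ v → H.Adj u v)
    (hiso : ∀ u ∈ I, ∀ v, ¬ H.Adj u v) (hW : W ⊆ I) (hD : D ⊆ I) (hle : H ≤ H')
    (hdiff : ∀ u v, H'.Adj u v → ¬ H.Adj u v → u ∈ W ∧ v ∈ D ∨ u ∈ D ∧ v ∈ W)
    {p : ℝ≥0∞} {τ : ℕ} (hτ : ∀ t < τ, 2 * t < C.card)
    (hpC : ∀ t < τ, (2 * W.card : ℝ≥0∞) ≤ p * (C.card - 2 * t : ℕ))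
    (hI : I.Nonempty) (hpI : ((W ∪ D).card : ℝ≥0∞) ≤ p * I.card) :
    ∑ π, (a.successProb (permute π H) ε + a.successProb (permute π H') ε) ≤
      ∑ π, (1 + (p * a.expectedQueries (permute π H) +
        ((τ + 1 : ℕ) : ℝ≥0∞)⁻¹ * a.expectedQueries (permute π H'))) := by
  classical
  -- An independent-set query can detect an added edge only if it contains both ends, one of which
  -- is in `W`; so `D`, which may be large, is ignored there.
  set hit : Equiv.Perm (Fin n) → Query n → Prop := fun π Q => match Q with
    | .degree v => ∃ b ∈ W ∪ D, v = π b
    | .neighbor v => ∃ b ∈ W ∪ D, v = π b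
    | .indepSet S => ∃ b ∈ W, π b ∈ touched (permute π H) (.indepSet S) with hhitdef
  have hlocal : ∀ (π : Equiv.Perm (Fin n)) (v : Fin n), (¬ ∃ b ∈ W ∪ D, v = π b) →
      ∀ u, (permute π H).Adj v u ↔ (permute π H').Adj v u := by
    intro π v hv u
    refine ⟨fun h => hle h, fun h => ?_⟩
    by_contra hn
    refine hv ⟨π.symm v, ?_, by simp⟩
    rcases hdiff _ _ h hn with h | h
    · exact Finset.mem_union_left _ h.1
    · exact Finset.mem_union_right _ h.1
  refine sum_successProb_le a hdisj (hit := hit) ?_ ?_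
  · rintro π (v | v | S) hQ
    · exact oracle_degree_congr (hlocal π v hQ)
    · exact oracle_neighbor_congr (hlocal π v hQ)
    · refine oracle_indepSet_congr ⟨fun h u hu v hv huv hadj => ?_, fun h u hu v hv huv hadj =>
        h hu hv huv (hle hadj)⟩
      have hS := touched_indepSet_of_isIndepSet h
      simp only [hhitdef, hS, not_exists, not_and] at hQ
      rcases hdiff _ _ hadj (h hu hv huv) with h' | h'
      · exact hQ _ h'.1 (by simpa using hu)
      · exact hQ _ h'.2 (by simpa using hv)
  · intro t ht
    have hCt0 : ((C.card - 2 * t : ℕ) : ℝ≥0∞) ≠ 0 := by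
      have := hτ t ht
      simpa only [ne_eq, Nat.cast_eq_zero] using (by omega : ¬ C.card - 2 * t = 0)
    have hindep : ∑ π, (a.history (permute π H) t).toOuterMeasure
        {h | a.Clean (hit π) h ∧ ∃ S, a h = .inl (.indepSet S) ∧ hit π (.indepSet S)} ≤
        p * ∑ π, (a.history (permute π H) t).toOuterMeasure a.askingIndepSet := by
      have hb : ∀ π : Equiv.Perm (Fin n), (a.history (permute π H) t).toOuterMeasure
          {h | a.Clean (hit π) h ∧ ∃ S, a h = .inl (.indepSet S) ∧ hit π (.indepSet S)} ≤
          ∑ b ∈ W, (a.history (permute π H) t).toOuterMeasure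
            {h | ∃ S, a h = .inl (.indepSet S) ∧ π b ∈ touched (permute π H) (.indepSet S) ∧
              π b ∉ a.revealedSet (permute π H) h} := by
        intro π
        refine le_trans (PMF.toOuterMeasure_mono _ ?_)
          (MeasureTheory.measure_biUnion_finset_le W _)
        -- Without an earlier hit, no label of `W` is revealed: direct queries to it and readings of
        -- it are hits, and an isolated vertex is nobody's neighbor.
        rintro h ⟨⟨hc, S, hS, b, hb, hbS⟩, hsupp⟩
        refine Set.mem_iUnion₂.2 ⟨b, hb, S, hS, hbS, ?_⟩
        refine history_support_induction a (permute π H)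
          (motive := fun _ h => a.Clean (hit π) h → π b ∉ a.revealedSet (permute π H) h)
          (fun _ => by simp [revealedSet]) (fun _ _ h => h) ?_ hsupp hc
        rintro t x h Q ih hQ hx ⟨hc, hnot⟩
        rw [revealedSet_cons hQ, Finset.mem_union, not_or]
        refine ⟨ih hc, fun hmem => ?_⟩
        have hnot := hnot Q hQ
        have hbWD : b ∈ W ∪ D := Finset.mem_union_left _ hb
        unfold revealed at hmem
        split at hmem
        · next v u =>
          simp only [Finset.mem_insert, Finset.mem_singleton] at hmem
          rcases hmem with hmem | hmem
          · exact hnot ⟨b, hbWD, hmem.symm⟩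
          · rw [oracle_neighbor_apply_some] at hx
            refine hx (if_neg fun hadj => hiso b (hW hb) (π.symm v) ?_)
            rw [SimpleGraph.adj_comm, permute_adj, ← hmem, Equiv.symm_apply_apply] at hadj
            exact hadj
        · rcases Q with v | v | S
          · exact hnot ⟨b, hbWD, by simpa [touched, eq_comm] using hmem⟩
          · exact hnot ⟨b, hbWD, by simpa [touched, eq_comm] using hmem⟩
          · exact hnot ⟨b, hb, hmem⟩
      refine (Finset.sum_le_sum fun π _ => hb π).trans ?_
      rw [Finset.sum_comm, ← ENNReal.mul_le_mul_iff_right hCt0 (ENNReal.natCast_ne_top _),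
        Finset.mul_sum]
      refine (Finset.sum_le_sum fun b hb =>
        mul_sum_history_touched_le a hclique (hiso b (hW hb)) t).trans ?_
      rw [Finset.sum_const, nsmul_eq_mul, ← mul_assoc, ← mul_assoc]
      refine mul_le_mul_left ?_ _
      rw [mul_comm, mul_comm _ p]
      exact hpC t ht
    have hloc : ∑ π, (a.history (permute π H) t).toOuterMeasure
        {h | h ∈ a.askingLocal ∧ ∃ Q, a h = .inl Q ∧ hit π Q} ≤
        p * ∑ π, (a.history (permute π H) t).toOuterMeasure a.askingLocal := by
      have hI0 : (I.card : ℝ≥0∞) ≠ 0 := by simpa using hI.ne_empty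
      rw [← ENNReal.mul_le_mul_iff_right hI0 (ENNReal.natCast_ne_top _)]
      have hswap : ∀ i ∈ I, ∀ j ∈ I, permute (Equiv.swap i j) H = H := by
        intro i hi j hj
        exact permute_swap_eq_self fun u _ _ => iff_of_false (hiso i hi u) (hiso j hj u)
      set v : SimpleGraph (Fin n) → List (Answer n) → Option (Fin n) := fun _ h => match a h with
        | .inl (.degree v) => some v
        | .inl (.neighbor v) => some v
        | _ => none with hv
      have key := card_mul_sum_history_permute_le a hswap (Finset.union_subset hW hD) t
        a.askingLocal v
      refine le_trans ?_ (key.trans ?_)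
      · refine mul_le_mul' le_rfl (Finset.sum_le_sum fun π _ => MeasureTheory.measure_mono ?_)
        rintro h ⟨hl, Q, hQ, hh⟩
        refine ⟨hl, ?_⟩
        rcases Q with u | u | S
        · obtain ⟨b, hb, rfl⟩ := hh
          exact ⟨b, hb, by simp [hv, hQ]⟩
        · obtain ⟨b, hb, rfl⟩ := hh
          exact ⟨b, hb, by simp [hv, hQ]⟩
        · obtain ⟨u, hu | hu⟩ := hl <;> rw [hQ] at hu <;> cases hu
      · rw [← mul_assoc, mul_comm _ p]
        gcongr
    calc ∑ π, (a.history (permute π H) t).toOuterMeasure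
          {h | a.Clean (hit π) h ∧ ∃ Q, a h = .inl Q ∧ hit π Q}
        ≤ ∑ π, ((a.history (permute π H) t).toOuterMeasure
            {h | a.Clean (hit π) h ∧ ∃ S, a h = .inl (.indepSet S) ∧ hit π (.indepSet S)} +
          (a.history (permute π H) t).toOuterMeasure
            {h | h ∈ a.askingLocal ∧ ∃ Q, a h = .inl Q ∧ hit π Q}) := by
          refine Finset.sum_le_sum fun π _ => le_trans (MeasureTheory.measure_mono ?_)
            (MeasureTheory.measure_union_le _ _)
          rintro h ⟨hc, Q, hQ, hh⟩
          rcases Q with v | v | S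
          · exact Or.inr ⟨⟨v, Or.inl hQ⟩, _, hQ, hh⟩
          · exact Or.inr ⟨⟨v, Or.inr hQ⟩, _, hQ, hh⟩
          · exact Or.inl ⟨hc, S, hQ, hh⟩
      _ ≤ p * ∑ π, (a.history (permute π H) t).toOuterMeasure a.askingIndepSet +
          p * ∑ π, (a.history (permute π H) t).toOuterMeasure a.askingLocal := by
          rw [Finset.sum_add_distrib]
          exact add_le_add hindep hloc
      _ = _ := by
          rw [← mul_add, ← Finset.sum_add_distrib]
          simp only [← PMF.toOuterMeasure_union_of_disjoint _
            a.disjoint_askingIndepSet_askingLocal, askingIndepSet_union_askingLocal]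

/-- The case of edges removed between interchangeable vertices. -/
theorem sum_successProb_le_of_twins {H H' : SimpleGraph (Fin n)} {ε : ℝ}
    (hdisj : NoCommonEstimate ε (edgeCount H) (edgeCount H'))
    {B C : Finset (Fin n)} (hC : ∀ i ∈ C, ∀ j ∈ C, permute (Equiv.swap i j) H = H) (hBC : B ⊆ C)
    (hle : H' ≤ H) (hdiff : ∀ u v, H.Adj u v → ¬ H'.Adj u v → u ∈ B)
    {p : ℝ≥0∞} (hC0 : C.Nonempty) (hp : (B.card : ℝ≥0∞) ≤ p * C.card) (τ : ℕ) :
    ∑ π, (a.successProb (permute π H) ε + a.successProb (permute π H') ε) ≤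
      ∑ π, (1 + (p * a.expectedQueries (permute π H) +
        ((τ + 1 : ℕ) : ℝ≥0∞)⁻¹ * a.expectedQueries (permute π H'))) := by
  set hit : Equiv.Perm (Fin n) → Query n → Prop :=
    fun π Q => ∃ b ∈ B, probe (permute π H) Q = some (π b) with hhitdef
  have hlocal : ∀ (π : Equiv.Perm (Fin n)) (v : Fin n), (¬ ∃ b ∈ B, some v = some (π b)) →
      ∀ u, (permute π H).Adj v u ↔ (permute π H').Adj v u := by
    intro π v hv u
    refine ⟨fun h => ?_, fun h => hle h⟩
    by_contra hn
    exact hv ⟨π.symm v, hdiff _ _ h hn, by simp⟩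
  refine sum_successProb_le a hdisj (hit := hit) ?_ ?_
  · rintro π (v | v | S) hQ
    · exact oracle_degree_congr (hlocal π v hQ)
    · exact oracle_neighbor_congr (hlocal π v hQ)
    · refine oracle_indepSet_congr ⟨fun h u hu v hv huv hadj => h hu hv huv (hle hadj),
        fun h u hu v hv huv hadj => ?_⟩
      -- If `S` is independent only after the removal, every edge inside `S` was removed, so
      -- whichever end `probe` chose lies in `B`.
      have hex : ∃ u ∈ S, ∃ v ∈ S, (permute π H).Adj u v := ⟨u, hu, v, hv, hadj⟩
      obtain ⟨hx, y, hy, hxy⟩ := hex.choose_spec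
      refine hQ ⟨π.symm hex.choose, hdiff _ _ hxy (h hx hy hxy.ne), ?_⟩
      simp only [probe, dif_pos hex, Equiv.apply_symm_apply]
  · intro t _
    have hC0' : (C.card : ℝ≥0∞) ≠ 0 := by simpa using hC0.ne_empty
    rw [← ENNReal.mul_le_mul_iff_right hC0' (ENNReal.natCast_ne_top _)]
    have key := card_mul_sum_history_permute_le a hC hBC t a.running
      fun G h => (a h).elim (fun Q => probe G Q) fun _ => none
    refine le_trans ?_ (key.trans ?_)
    · refine mul_le_mul' le_rfl (Finset.sum_le_sum fun π _ => MeasureTheory.measure_mono ?_)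
      rintro h ⟨-, Q, hQ, b, hb, hh⟩
      exact ⟨⟨Q, hQ⟩, b, hb, by rw [hQ]; exact hh⟩
    · rw [← mul_assoc, mul_comm _ p]
      gcongr

end DetAlgorithm

/-! ### Construction of the graphs with prescribed edge counts. -/

section Graphs

theorem exists_edgeCount_eq_of_le {L U : SimpleGraph (Fin n)} (h : L ≤ U) {m : ℕ}
    (h1 : edgeCount L ≤ m) (h2 : m ≤ edgeCount U) : ∃ H, L ≤ H ∧ H ≤ U ∧ edgeCount H = m := by
  obtain ⟨s, hLs, hsU, hs⟩ :=
    Set.exists_subsuperset_card_eq (SimpleGraph.edgeSet_mono h) h1 h2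
  have hdiag : s \ {e | e.IsDiag} = s := by
    refine sdiff_eq_left.2 (Set.disjoint_left.2 fun e he hd => ?_)
    exact U.not_isDiag_of_mem_edgeSet (hsU he) hd
  have hedge : (SimpleGraph.fromEdgeSet s).edgeSet = s := by
    rw [SimpleGraph.edgeSet_fromEdgeSet]
    exact hdiag
  refine ⟨SimpleGraph.fromEdgeSet s, ?_, ?_, ?_⟩
  · rw [← SimpleGraph.edgeSet_subset_edgeSet, hedge]; exact hLs
  · rw [← SimpleGraph.edgeSet_subset_edgeSet, hedge]; exact hsU
  · rw [edgeCount, hedge, hs]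

/-- The complete graph on the vertices of `C`. -/
def cliqueOn (C : Finset (Fin n)) : SimpleGraph (Fin n) where
  Adj u v := u ≠ v ∧ u ∈ C ∧ v ∈ C
  symm := ⟨fun _ _ h => ⟨h.1.symm, h.2.2, h.2.1⟩⟩
  loopless := ⟨fun _ h => h.1 rfl⟩

theorem edgeCount_cliqueOn (C : Finset (Fin n)) : edgeCount (cliqueOn C) = C.card.choose 2 := by
  rw [← Sym2.card_image_offDiag, ← Set.ncard_coe_finset, edgeCount]
  congr 1
  ext e
  induction e with | _ u v
  simp only [SimpleGraph.mem_edgeSet, cliqueOn, Finset.coe_image, Set.mem_image, Finset.mem_coe,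
    Finset.mem_offDiag, Prod.exists, Function.uncurry_apply_pair, Sym2.eq_iff]
  constructor
  · rintro ⟨h1, h2, h3⟩
    exact ⟨u, v, ⟨h2, h3, h1⟩, Or.inl ⟨rfl, rfl⟩⟩
  · rintro ⟨x, y, ⟨h1, h2, h3⟩, ⟨rfl, rfl⟩ | ⟨rfl, rfl⟩⟩
    · exact ⟨h3, h1, h2⟩
    · exact ⟨h3.symm, h2, h1⟩

/-- The complete bipartite graph between the disjoint sets `W` and `D`. -/
def bipartiteOn (W D : Finset (Fin n)) (h : Disjoint W D) : SimpleGraph (Fin n) where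
  Adj u v := u ∈ W ∧ v ∈ D ∨ u ∈ D ∧ v ∈ W
  symm := ⟨fun _ _ h => h.symm.imp And.symm And.symm⟩
  loopless := ⟨fun u hu => by
    rcases hu with hu | hu
    · exact Finset.disjoint_left.1 h hu.1 hu.2
    · exact Finset.disjoint_left.1 h hu.2 hu.1⟩

theorem edgeCount_bipartiteOn {W D : Finset (Fin n)} (h : Disjoint W D) :
    edgeCount (bipartiteOn W D h) = W.card * D.card := by
  have himg : (bipartiteOn W D h).edgeSet =
      (fun p : Fin n × Fin n => s(p.1, p.2)) '' (W ×ˢ D : Finset (Fin n × Fin n)) := by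
    ext e
    induction e with | _ u v
    simp only [SimpleGraph.mem_edgeSet, bipartiteOn, Set.mem_image, Finset.mem_coe,
      Finset.mem_product, Prod.exists, Sym2.eq_iff]
    constructor
    · rintro (⟨h1, h2⟩ | ⟨h1, h2⟩)
      · exact ⟨u, v, ⟨h1, h2⟩, Or.inl ⟨rfl, rfl⟩⟩
      · exact ⟨v, u, ⟨h2, h1⟩, Or.inr ⟨rfl, rfl⟩⟩
    · rintro ⟨x, y, ⟨h1, h2⟩, ⟨rfl, rfl⟩ | ⟨rfl, rfl⟩⟩
      · exact Or.inl ⟨h1, h2⟩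
      · exact Or.inr ⟨h2, h1⟩
  rw [edgeCount, himg, Set.InjOn.ncard_image, Set.ncard_coe_finset, Finset.card_product]
  rintro ⟨u, v⟩ hp ⟨x, y⟩ hq he
  simp only [Finset.mem_coe, Finset.mem_product] at hp hq
  rcases Sym2.eq_iff.1 he with ⟨rfl, rfl⟩ | ⟨rfl, rfl⟩
  · rfl
  · exact (Finset.disjoint_left.1 h hp.1 hq.2).elim

theorem edgeCount_sup_of_disjoint {G K : SimpleGraph (Fin n)} (h : Disjoint G K) :
    edgeCount (G ⊔ K) = edgeCount G + edgeCount K := by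
  rw [edgeCount, SimpleGraph.edgeSet_sup]
  exact Set.ncard_union_eq (SimpleGraph.disjoint_edgeSet.2 h) (Set.toFinite _) (Set.toFinite _)

theorem edgeCount_sdiff_add {G K : SimpleGraph (Fin n)} (h : K ≤ G) :
    edgeCount (G \ K) + edgeCount K = edgeCount G := by
  rw [← edgeCount_sup_of_disjoint disjoint_sdiff_self_left, sdiff_sup_cancel h]

/-- Every number of edges is attained by a clique together with a part of the edges from one
further vertex to it. -/
theorem exists_clique_edgeCount_eq {m : ℕ} (hm : 1 ≤ m) (hmn : m ≤ n.choose 2) :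
    ∃ (H : SimpleGraph (Fin n)) (C : Finset (Fin n)) (z : Fin n), z ∉ C ∧
      C.card.choose 2 < m ∧ m ≤ (C.card + 1).choose 2 ∧ edgeCount H = m ∧
      (∀ u ∈ C, ∀ v ∈ C, u ≠ v → H.Adj u v) ∧
      ∀ u v, H.Adj u v → u ∈ insert z C := by
  have hex : ∃ j : ℕ, m ≤ j.choose 2 := ⟨n, hmn⟩
  -- The least clique size providing `m` edges is `k + 1`; one vertex `z` of that clique then gives
  -- up the surplus edges.
  obtain ⟨k, hk⟩ : ∃ k, Nat.find hex = k + 1 := by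
    refine Nat.exists_eq_succ_of_ne_zero fun h0 => ?_
    have := Nat.find_spec hex
    rw [h0] at this
    simp at this
    omega
  have hk1 : m ≤ (k + 1).choose 2 := hk ▸ Nat.find_spec hex
  have hk2 : k.choose 2 < m := not_le.1 (Nat.find_min hex (by omega))
  have hkn : k + 1 ≤ n := hk ▸ Nat.find_min' hex hmn
  obtain ⟨T, -, hT⟩ := Finset.exists_subset_card_eq
    (s := (Finset.univ : Finset (Fin n))) (n := k + 1) (by simpa using hkn)
  obtain ⟨z, hz⟩ := Finset.card_pos.1 (by omega : 0 < T.card)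
  have hC : (T.erase z).card = k := by rw [Finset.card_erase_of_mem hz, hT]; rfl
  obtain ⟨H, hLH, hHU, hH⟩ := exists_edgeCount_eq_of_le
    (L := cliqueOn (T.erase z)) (U := cliqueOn T) (m := m)
    (fun u v h => ⟨h.1, Finset.mem_of_mem_erase h.2.1, Finset.mem_of_mem_erase h.2.2⟩)
    (by rw [edgeCount_cliqueOn, hC]; exact hk2.le) (by rw [edgeCount_cliqueOn, hT]; exact hk1)
  refine ⟨H, T.erase z, z, Finset.notMem_erase z T, by rwa [hC], by rwa [hC], hH,
    fun u hu v hv huv => hLH ⟨huv, hu, hv⟩, fun u v huv => ?_⟩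
  rw [Finset.insert_erase hz]
  exact (hHU huv).2.1

theorem exists_disjoint_subsets_card_eq {I : Finset (Fin n)} {w d : ℕ} (h : w + d ≤ I.card) :
    ∃ W D : Finset (Fin n), W ⊆ I ∧ D ⊆ I ∧ Disjoint W D ∧ W.card = w ∧ D.card = d := by
  obtain ⟨W, hW, hw⟩ := Finset.exists_subset_card_eq (s := I) (n := w) (by omega)
  obtain ⟨D, hD, hd⟩ := Finset.exists_subset_card_eq (s := I \ W) (n := d) (by
    rw [Finset.card_sdiff_of_subset hW]; omega)
  exact ⟨W, D, hW, hD.trans Finset.sdiff_subset,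
    Finset.disjoint_of_subset_right hD Finset.disjoint_sdiff, hw, hd⟩

theorem exists_add_bipartite {H : SimpleGraph (Fin n)} {I : Finset (Fin n)} {m w d : ℕ}
    (hiso : ∀ u ∈ I, ∀ v, ¬ H.Adj u v) (hwd : w + d ≤ I.card) (hm : edgeCount H ≤ m)
    (hm' : m ≤ edgeCount H + w * d) :
    ∃ (H' : SimpleGraph (Fin n)) (W D : Finset (Fin n)), W ⊆ I ∧ D ⊆ I ∧ W.card = w ∧ D.card = d ∧
      H ≤ H' ∧ edgeCount H' = m ∧
      ∀ u v, H'.Adj u v → ¬ H.Adj u v → u ∈ W ∧ v ∈ D ∨ u ∈ D ∧ v ∈ W := by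
  obtain ⟨W, D, hW, hD, hWD, hw, hd⟩ := exists_disjoint_subsets_card_eq hwd
  have hdisj : Disjoint H (bipartiteOn W D hWD) := by
    rw [SimpleGraph.disjoint_left]
    rintro u v huv (h | h)
    · exact hiso u (hW h.1) v huv
    · exact hiso u (hD h.1) v huv
  obtain ⟨H', h1, h2, h3⟩ := exists_edgeCount_eq_of_le (L := H) (U := H ⊔ bipartiteOn W D hWD)
    le_sup_left hm (by
      rw [edgeCount_sup_of_disjoint hdisj, edgeCount_bipartiteOn, hw, hd]
      exact hm')
  refine ⟨H', W, D, hW, hD, hw, hd, h1, h3, fun u v huv hn => ?_⟩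
  exact (h2 huv).resolve_left hn

theorem exists_remove_bipartite {H : SimpleGraph (Fin n)} {C : Finset (Fin n)} {m w d : ℕ}
    (hclique : ∀ u ∈ C, ∀ v ∈ C, u ≠ v → H.Adj u v) (hwd : w + d ≤ C.card)
    (hm : m ≤ edgeCount H) (hm' : edgeCount H ≤ m + w * d) :
    ∃ (H' : SimpleGraph (Fin n)) (B : Finset (Fin n)), B ⊆ C ∧ B.card = w + d ∧ H' ≤ H ∧
      edgeCount H' = m ∧ ∀ u v, H.Adj u v → ¬ H'.Adj u v → u ∈ B := by
  obtain ⟨W, D, hW, hD, hWD, hw, hd⟩ := exists_disjoint_subsets_card_eq hwd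
  have hK : bipartiteOn W D hWD ≤ H := by
    rintro u v (h | h)
    · exact hclique u (hW h.1) v (hD h.2) fun e => Finset.disjoint_left.1 hWD h.1 (e ▸ h.2)
    · exact hclique u (hD h.1) v (hW h.2) fun e => Finset.disjoint_left.1 hWD h.2 (e ▸ h.1)
  have hcount := edgeCount_sdiff_add hK
  rw [edgeCount_bipartiteOn, hw, hd] at hcount
  obtain ⟨H', h1, h2, h3⟩ := exists_edgeCount_eq_of_le (L := H \ bipartiteOn W D hWD) (U := H)
    sdiff_le (by omega) hm
  refine ⟨H', W ∪ D, Finset.union_subset hW hD, by rw [Finset.card_union_of_disjoint hWD, hw, hd],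
    h2, h3, fun u v huv hn => ?_⟩
  by_contra hB
  rw [Finset.mem_union, not_or] at hB
  refine hn (h1 ⟨huv, ?_⟩)
  rintro (h | h)
  · exact hB.1 h.1
  · exact hB.2 h.1

/-- At least half of the clique consists of interchangeable vertices. -/
theorem exists_twins {H : SimpleGraph (Fin n)} {C : Finset (Fin n)} {z : Fin n}
    (hclique : ∀ u ∈ C, ∀ v ∈ C, u ≠ v → H.Adj u v)
    (hsub : ∀ u v, H.Adj u v → u ∈ insert z C) :
    ∃ C' ⊆ C, C.card ≤ 2 * C'.card ∧ ∀ i ∈ C', ∀ j ∈ C', permute (Equiv.swap i j) H = H := by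
  classical
  have htwin : ∀ i ∈ C, ∀ j ∈ C, (H.Adj z i ↔ H.Adj z j) → permute (Equiv.swap i j) H = H := by
    intro i hi j hj hz
    refine permute_swap_eq_self fun u hui huj => ?_
    by_cases hu : u ∈ C
    · exact iff_of_true (hclique i hi u hu hui.symm) (hclique j hj u hu huj.symm)
    by_cases huz : u = z
    · rw [huz, H.adj_comm, hz, H.adj_comm]
    · refine iff_of_false (fun h => ?_) (fun h => ?_)
      · exact (Finset.mem_insert.1 (hsub u _ h.symm)).elim huz hu
      · exact (Finset.mem_insert.1 (hsub u _ h.symm)).elim huz hu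
  have hcard := Finset.card_filter_add_card_filter_not (s := C) fun i => H.Adj z i
  rcases le_total (C.filter fun i => H.Adj z i).card (C.filter fun i => ¬ H.Adj z i).card with h | h
  · refine ⟨C.filter fun i => ¬ H.Adj z i, Finset.filter_subset _ _, by omega, fun i hi j hj => ?_⟩
    rw [Finset.mem_filter] at hi hj
    exact htwin i hi.1 j hj.1 (iff_of_false hi.2 hj.2)
  · refine ⟨C.filter fun i => H.Adj z i, Finset.filter_subset _ _, by omega, fun i hi j hj => ?_⟩
    rw [Finset.mem_filter] at hi hj
    exact htwin i hi.1 j hj.1 (iff_of_true hi.2 hj.2)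

end Graphs

/-! ### Numerical estimates. -/

section Numbers

/-- The largest count separated from `m`; its maximality keeps it within the allowed window, up to
one edge. -/
theorem exists_lower_count {m : ℕ} (hm : 1 ≤ m) {ε : ℝ} (hε : 0 < ε) (hε' : ε ≤ 9 / 10) :
    ∃ m₁ : ℕ, (1 + ε) * m₁ < (1 - ε) * m ∧ (1 - ε) * m ≤ (1 + ε) * (m₁ + 1) := by
  have hm0 : (1 : ℝ) ≤ m := by exact_mod_cast hm
  have hpos : 0 < (1 - ε) * m / (1 + ε) := by
    have : 0 < 1 - ε := by linarith
    positivity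
  obtain ⟨m₁, hm₁⟩ : ∃ m₁, ⌈(1 - ε) * m / (1 + ε)⌉₊ = m₁ + 1 :=
    Nat.exists_eq_succ_of_ne_zero (Nat.ceil_pos.2 hpos).ne'
  have h1 := Nat.le_ceil ((1 - ε) * m / (1 + ε))
  have h2 := Nat.ceil_lt_add_one hpos.le
  rw [hm₁] at h1 h2
  push_cast at h1 h2
  refine ⟨m₁, ?_, ?_⟩
  · rw [add_lt_add_iff_right, lt_div_iff₀ (by linarith)] at h2
    linarith
  · rw [div_le_iff₀ (by linarith)] at h1
    linarith

theorem rate_nonneg (n m : ℕ) (ε : ℝ) : 0 ≤ rate n m ε := by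
  unfold rate
  positivity

theorem rate_le (n m : ℕ) (ε : ℝ) : 30 * rate n m ε ≤ Real.sqrt m := by
  have := min_le_left (Real.sqrt m) (Real.sqrt (n / (ε * Real.sqrt m)))
  unfold rate
  linarith

theorem sq_rate_mul_le {n m : ℕ} (hm : 1 ≤ m) {ε : ℝ} (hε : 0 < ε) :
    900 * rate n m ε ^ 2 * (ε * Real.sqrt m) ≤ n := by
  have hs : 0 < ε * Real.sqrt m := mul_pos hε (Real.sqrt_pos.2 (by exact_mod_cast hm))
  have h1 : 30 * rate n m ε ≤ Real.sqrt (n / (ε * Real.sqrt m)) := by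
    have := min_le_right (Real.sqrt m) (Real.sqrt (n / (ε * Real.sqrt m)))
    unfold rate
    linarith
  have h2 : (30 * rate n m ε) ^ 2 ≤ n / (ε * Real.sqrt m) := by
    rw [← Real.sq_sqrt (show 0 ≤ n / (ε * Real.sqrt m) by positivity)]
    exact pow_le_pow_left₀ (by linarith [rate_nonneg n m ε]) h1 2
  rw [le_div_iff₀ hs] at h2
  linarith

theorem le_ofReal_inv {ρ r : ℝ} (hρ : 0 ≤ ρ) (h : ρ * r ≤ 1) :
    ENNReal.ofReal ρ ≤ (ENNReal.ofReal r)⁻¹ := by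
  rw [ENNReal.le_inv_iff_mul_le, ← ENNReal.ofReal_mul hρ]
  exact ENNReal.ofReal_le_one.2 h

theorem natCast_inv_le_ofReal_inv {k : ℕ} {r : ℝ} (h : r ≤ k) :
    (k : ℝ≥0∞)⁻¹ ≤ (ENNReal.ofReal r)⁻¹ := by
  rw [ENNReal.inv_le_inv]
  exact ENNReal.ofReal_le_of_le_toReal (by simpa using h)

theorem natCast_le_ofReal_mul {b k : ℕ} {ρ : ℝ} (hρ : 0 ≤ ρ) (h : (b : ℝ) ≤ ρ * k) :
    (b : ℝ≥0∞) ≤ ENNReal.ofReal ρ * k := by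
  rw [← ENNReal.ofReal_natCast b, ← ENNReal.ofReal_natCast k, ← ENNReal.ofReal_mul hρ]
  exact ENNReal.ofReal_le_ofReal h

theorem two_mul_le_of_le_choose {m k : ℕ} (h : m ≤ (k + 1).choose 2) :
    2 * (m : ℝ) ≤ k * (k + 1) := by
  have h2 := Nat.choose_two_right (k + 1)
  have h3 : 2 * m ≤ (k + 1) * k := by
    have := Nat.div_mul_le_self ((k + 1) * k) 2
    simp only [Nat.add_sub_cancel] at h2
    omega
  have : ((2 * m : ℕ) : ℝ) ≤ ((k + 1) * k : ℕ) := by exact_mod_cast h3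
  push_cast at this
  linarith

theorem mul_le_of_choose_lt {m k : ℕ} (h : k.choose 2 < m) : (k : ℝ) * (k - 1) ≤ 2 * m := by
  have h2 : ((k.choose 2 : ℕ) : ℝ) = k * (k - 1) / 2 := Nat.cast_choose_two ℝ k
  have : ((k.choose 2 : ℕ) : ℝ) ≤ m := by exact_mod_cast h.le
  linarith

/-- The sizes of the bipartite graph to be removed in the dense case. -/
theorem dense_sizes {s e R k c a w : ℝ} (hs : 30 < s) (he : 0 ≤ e) (hR : 1 < R) (hRs : 30 * R ≤ s)
    (hRe : 900 * R ^ 2 * (e ^ 2 * s) ≤ 16 * s) (hk : 0 ≤ k) (hks : 2 * s ^ 2 ≤ k * (k + 1))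
    (hc : k ≤ 2 * c) (ha : a ≤ 2 * e ^ 2 * s ^ 2 + 1) (hw : w ≤ Real.sqrt a + 1) :
    2 * w * R ≤ c := by
  have h1 : Real.sqrt a ≤ 3 / 2 * (e * s) + 1 := by
    refine Real.sqrt_le_iff.2 ⟨by positivity, ha.trans ?_⟩
    nlinarith [mul_nonneg he (by linarith : (0 : ℝ) ≤ s), sq_nonneg (e * s)]
  -- Here `s = √m`, `e = √ε`. With `n ≤ 16 s` the rate is at most a constant over `√ε`, so `2 w R ≤
  -- 3 R e s + 4 R ≤ (8/15) s`, below half of `k ≥ (11/10) s`.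
  have h2 : R * e ≤ 2 / 15 := by
    have h3 : 900 * R ^ 2 * e ^ 2 ≤ 16 := by
      refine le_of_mul_le_mul_right (a := s) ?_ (by linarith)
      linarith
    have h4 : (R * e) ^ 2 ≤ (2 / 15) ^ 2 := by nlinarith
    exact (sq_le_sq₀ (by positivity) (by norm_num)).1 h4
  have h5 : 11 / 10 * s ≤ k := by
    by_contra! hlt
    nlinarith
  have h6 : 2 * w * R ≤ 2 * (3 / 2 * (e * s) + 2) * R := by
    gcongr
    linarith
  have h7 : R * e * s ≤ 2 / 15 * s := by gcongr
  nlinarith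

/-- The clique in the sparse case is large enough. -/
theorem sparse_clique {s m₁ k : ℝ} (hs : 30 < s) (hm₁ : s ^ 2 ≤ 19 * (m₁ + 1)) (hk : 0 ≤ k)
    (hkm : 2 * m₁ ≤ k * (k + 1)) : 4 * s ≤ 15 * k := by
  by_contra! hlt
  have h1 : k * (k + 1) ≤ 4 / 15 * s * (4 / 15 * s + 1) := by
    gcongr <;> linarith
  nlinarith

/-- The sizes of the bipartite graph to be added in the sparse case. -/
theorem sparse_sizes {s s₁ ε R k n a w d : ℝ} (hs : 30 < s) (hs₁ : 1 ≤ s₁) (hs₁s : s₁ ≤ s)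
    (hε : 0 < ε) (hR : 1 < R) (hRs : 30 * R ≤ s) (hRn : 900 * R ^ 2 * (ε * s₁) ≤ n)
    (hn : 16 * s < n) (hsk : 4 * s ≤ 15 * k) (hkm : 2 * s₁ ^ 2 ≤ k * (k + 1))
    (hkm' : k * (k - 1) ≤ 2 * s₁ ^ 2) (ha : a ≤ 20 * ε * (s₁ ^ 2 + 1) + 1)
    (hw : w ≤ k / (8 * R) + 1) (hd : d ≤ 8 * a * R / k + 1) :
    4 * w * R ≤ k ∧ (w + d) * R ≤ n - k - 1 := by
  have hk : 8 ≤ k := by linarith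
  -- The rounding in `w` costs one more `R`; since `R ≤ k / 8`, still `w R ≤ k / 4`.
  have hk8 : 8 * R ≤ k := by linarith
  have hwR : w * R ≤ k / 8 + R := by
    calc w * R ≤ (k / (8 * R) + 1) * R := by gcongr
      _ = k / 8 + R := by field_simp
  refine ⟨by linarith, ?_⟩
  have hks₁ : s₁ ≤ k := by
    by_contra! hlt
    nlinarith
  have hk3 : k ≤ 3 / 2 * s := by
    by_contra! hlt
    nlinarith
  have ha' : a ≤ 40 * ε * s₁ ^ 2 + 1 := by
    have h1 : 1 ≤ s₁ ^ 2 := one_le_pow₀ hs₁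
    nlinarith [mul_le_mul_of_nonneg_left h1 hε.le]
  -- The main term is at most `(320/900) n` by `hRn`; the rest is of order `s` and is absorbed by `n
  -- > 16 s`.
  have hdR : d * R ≤ 320 * R ^ 2 * (ε * s₁) + R + R := by
    calc d * R ≤ (8 * a * R / k + 1) * R := by gcongr
      _ = 8 * R ^ 2 * a / k + R := by ring
      _ ≤ 8 * R ^ 2 * (40 * ε * s₁ * k + 1) / k + R := by
          gcongr
          refine ha'.trans ?_
          have : 40 * ε * s₁ * s₁ ≤ 40 * ε * s₁ * k := by gcongr
          nlinarith
      _ = 320 * R ^ 2 * (ε * s₁) + R * (8 * R / k) + R := by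
          field_simp
          ring
      _ ≤ _ := by
          have : 8 * R / k ≤ 1 := (div_le_one (by linarith)).2 hk8
          have : R * (8 * R / k) ≤ R * 1 := by gcongr
          linarith
  nlinarith

end Numbers

/-! ### Hard pairs in the three regimes. -/

theorem NoCommonEstimate.of_lt {ε : ℝ} {m₁ m : ℕ} (h : (1 + ε) * m₁ < (1 - ε) * m) :
    NoCommonEstimate ε m₁ m :=
  fun _ _ h2 h3 _ => by linarith

theorem NoCommonEstimate.symm {ε : ℝ} {m₁ m : ℕ} (h : NoCommonEstimate ε m₁ m) :
    NoCommonEstimate ε m m₁ :=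
  fun x h1 h2 h3 h4 => h x h3 h4 h1 h2

/-- On average over the renamings of two graphs with `m` and `m'` edges, every deterministic
algorithm needs `ρ⁻¹` queries on the first or `ρ'⁻¹` queries on the second to estimate the number of
edges. -/
def HardPair (n m m' : ℕ) (ε : ℝ) (ρ ρ' : ℝ≥0∞) : Prop :=
  ∃ H H' : SimpleGraph (Fin n), edgeCount H = m ∧ edgeCount H' = m' ∧ ∀ a : DetAlgorithm n,
    ∑ π, (a.successProb (permute π H) ε + a.successProb (permute π H') ε) ≤
      ∑ π, (1 + (ρ * a.expectedQueries (permute π H) + ρ' * a.expectedQueries (permute π H')))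

/-- Cutting at `τ = 0`: an algorithm that asks nothing gives the same output on both graphs. The
weight 0 on the smaller graph also covers `m₁ = 0`, where the rate vanishes. -/
theorem hardPair_trivial {m₁ m : ℕ} {ε : ℝ} (hm : m ≤ n.choose 2) (hm₁ : m₁ ≤ n.choose 2)
    (hsep : (1 + ε) * m₁ < (1 - ε) * m) : HardPair n m₁ m ε 0 1 := by
  have hex : ∀ k ≤ n.choose 2, ∃ H : SimpleGraph (Fin n), edgeCount H = k := by
    intro k hk
    obtain ⟨H, -, -, hH⟩ := exists_edgeCount_eq_of_le (L := cliqueOn (∅ : Finset (Fin n)))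
      (U := cliqueOn Finset.univ) (m := k) (fun u v h => by simp [cliqueOn] at h)
      (by simp [edgeCount_cliqueOn]) (by simpa [edgeCount_cliqueOn] using hk)
    exact ⟨H, hH⟩
  obtain ⟨H, hH⟩ := hex m₁ hm₁
  obtain ⟨H', hH'⟩ := hex m hm
  refine ⟨H, H', hH, hH', fun a => ?_⟩
  have := a.sum_successProb_le (H := H) (H' := H') (ε := ε)
    (by rw [hH, hH']; exact NoCommonEstimate.of_lt hsep) (hit := fun _ _ => True)
    (fun _ _ h => (h trivial).elim) (p := 0) (τ := 0) (by simp)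
  simpa using this

/-- The twin argument needs no time limit, so `τ` is free and the bound on the graph with `m₁` edges
is as strong as desired. -/
theorem hardPair_dense {m₁ m : ℕ} {ε : ℝ} (hm : 1 ≤ m) (hmn : m ≤ n.choose 2) (hε : 0 < ε)
    (hm₁m : m₁ < m) (hsep : (1 + ε) * m₁ < (1 - ε) * m)
    (hsep' : (1 - ε) * m ≤ (1 + ε) * (m₁ + 1)) (hn : (n : ℝ) ≤ 16 * Real.sqrt m)
    (hR : 1 < rate n m ε) (τ : ℕ) :
    HardPair n m m₁ ε (ENNReal.ofReal (rate n m ε)⁻¹) ((τ + 1 : ℕ) : ℝ≥0∞)⁻¹ := by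
  obtain ⟨H, C, z, hz, -, hkm, hH, hclique, hsub⟩ := exists_clique_edgeCount_eq hm hmn
  obtain ⟨C', hC'C, hcard, htwin⟩ := exists_twins hclique hsub
  have hRs := rate_le n m ε
  have hs : 30 < Real.sqrt m := by linarith
  have hm₁m' : (m₁ : ℝ) + 1 ≤ m := by exact_mod_cast hm₁m
  have hss : Real.sqrt m ^ 2 = m := Real.sq_sqrt (Nat.cast_nonneg m)
  have hee : Real.sqrt ε ^ 2 = ε := Real.sq_sqrt hε.le
  have ha : ((m - m₁ : ℕ) : ℝ) = m - m₁ := by rw [Nat.cast_sub hm₁m.le]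
  set w := ⌈Real.sqrt ((m - m₁ : ℕ) : ℝ)⌉₊ with hw
  have hsize : 2 * (w : ℝ) * rate n m ε ≤ C'.card := by
    refine dense_sizes (s := Real.sqrt m) (e := Real.sqrt ε) (k := C.card)
      (a := ((m - m₁ : ℕ) : ℝ)) hs (Real.sqrt_nonneg _) hR hRs ?_ (Nat.cast_nonneg _) ?_ ?_ ?_ ?_
    · rw [hee]
      exact (sq_rate_mul_le hm hε).trans hn
    · rw [hss]
      exact two_mul_le_of_le_choose hkm
    · exact_mod_cast hcard
    · rw [hee, hss, ha]
      nlinarith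
    · exact (Nat.ceil_lt_add_one (Real.sqrt_nonneg _)).le
  have hwC : w + w ≤ C'.card := by
    have : ((w + w : ℕ) : ℝ) ≤ C'.card := by
      push_cast
      nlinarith [Nat.cast_nonneg (α := ℝ) w]
    exact_mod_cast this
  have hwpos : 0 < w := by
    rw [hw, Nat.ceil_pos, Real.sqrt_pos, Nat.cast_pos]
    omega
  have hww : m ≤ m₁ + w * w := by
    have h1 : Real.sqrt ((m - m₁ : ℕ) : ℝ) ≤ w := Nat.le_ceil _
    have h2 : ((m - m₁ : ℕ) : ℝ) ≤ ((w * w : ℕ) : ℝ) := by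
      rw [← Real.mul_self_sqrt (Nat.cast_nonneg (m - m₁))]
      push_cast
      exact mul_self_le_mul_self (Real.sqrt_nonneg _) h1
    have h3 : m - m₁ ≤ w * w := by exact_mod_cast h2
    omega
  obtain ⟨H', B, hBC, hB, hle, hH', hdiff⟩ := exists_remove_bipartite (H := H) (C := C') (m := m₁)
    (w := w) (d := w) (fun u hu v hv => hclique u (hC'C hu) v (hC'C hv)) hwC (by omega) (by omega)
  refine ⟨H, H', hH, hH', fun a => ?_⟩
  refine a.sum_successProb_le_of_twins ?_ htwin hBC hle hdiff (Finset.card_pos.1 (by omega)) ?_ τ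
  · rw [hH, hH']
    exact (NoCommonEstimate.of_lt hsep).symm
  · refine natCast_le_ofReal_mul (inv_nonneg.2 (by linarith)) ?_
    rw [hB, inv_mul_eq_div, le_div_iff₀ (by linarith)]
    push_cast
    linarith

/-- The conditions on `R` mix `√m` and `√m₁` so that the larger of the two rates is admissible. -/
theorem hardPair_sparse {m₁ m : ℕ} {ε R : ℝ} (hmn : m ≤ n.choose 2) (hε : 0 < ε)
    (hε' : ε ≤ 9 / 10) (hm₁ : 1 ≤ m₁) (hm₁m : m₁ < m) (hsep : (1 + ε) * m₁ < (1 - ε) * m)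
    (hsep' : (1 - ε) * m ≤ (1 + ε) * (m₁ + 1)) (hn : 16 * Real.sqrt m < n) (hR : 1 < R)
    (hRs : 30 * R ≤ Real.sqrt m) (hRn : 900 * R ^ 2 * (ε * Real.sqrt m₁) ≤ n) :
    HardPair n m₁ m ε (ENNReal.ofReal R⁻¹) (ENNReal.ofReal R)⁻¹ := by
  obtain ⟨H, C, z, hz, hkm', hkm, hH, hclique, hsub⟩ :=
    exists_clique_edgeCount_eq hm₁ (hm₁m.le.trans hmn)
  have hs : 30 < Real.sqrt m := by linarith
  have hss : Real.sqrt m ^ 2 = m := Real.sq_sqrt (Nat.cast_nonneg m)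
  have hss₁ : Real.sqrt m₁ ^ 2 = m₁ := Real.sq_sqrt (Nat.cast_nonneg m₁)
  have hm₁m' : (m₁ : ℝ) ≤ m := by exact_mod_cast hm₁m.le
  have hm₁' : (1 : ℝ) ≤ m₁ := by exact_mod_cast hm₁
  have hm0 : (0 : ℝ) ≤ m := Nat.cast_nonneg m
  have ha : ((m - m₁ : ℕ) : ℝ) = m - m₁ := by rw [Nat.cast_sub hm₁m.le]
  have hkm2 := two_mul_le_of_le_choose hkm
  have hsk : 4 * Real.sqrt m ≤ 15 * C.card := by
    -- The factor 19 is `(1 + ε) / (1 - ε)` at `ε = 9/10`.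
    refine sparse_clique (m₁ := m₁) hs ?_ (Nat.cast_nonneg _) hkm2
    rw [hss]
    nlinarith
  have hk0 : (0 : ℝ) < C.card := by linarith
  -- `w` is about as large as independent-set queries permit; `d` is then chosen so that `w * d ≥ m
  -- - m₁`.
  set w := ⌈(C.card : ℝ) / (8 * R)⌉₊ with hw
  set d := ⌈8 * ((m - m₁ : ℕ) : ℝ) * R / C.card⌉₊ with hd
  obtain ⟨hwk, hwd⟩ : 4 * (w : ℝ) * R ≤ C.card ∧ ((w : ℝ) + d) * R ≤ n - C.card - 1 := by
    refine sparse_sizes (s := Real.sqrt m) (s₁ := Real.sqrt m₁) (ε := ε)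
      (a := ((m - m₁ : ℕ) : ℝ)) hs (Real.one_le_sqrt.2 hm₁') (Real.sqrt_le_sqrt hm₁m') hε hR hRs
      hRn hn hsk ?_ ?_ ?_ ?_ ?_
    · rwa [hss₁]
    · rw [hss₁]
      exact mul_le_of_choose_lt hkm'
    · rw [hss₁, ha]
      have h1 : (1 - ε) * ((m : ℝ) - (m₁ + 1)) ≤ 2 * ε * (m₁ + 1) := by linarith
      have h2 : 1 / 10 * ((m : ℝ) - (m₁ + 1)) ≤ (1 - ε) * ((m : ℝ) - (m₁ + 1)) := by
        have : (m₁ : ℝ) + 1 ≤ m := by exact_mod_cast hm₁m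
        refine mul_le_mul_of_nonneg_right ?_ ?_ <;> linarith
      linarith
    · exact (Nat.ceil_lt_add_one (by positivity)).le
    · exact (Nat.ceil_lt_add_one (by positivity)).le
  set I : Finset (Fin n) := (insert z C)ᶜ with hI
  have hIcard : (I.card : ℝ) = n - C.card - 1 := by
    have := Finset.card_add_card_compl (insert z C)
    rw [Finset.card_insert_of_notMem hz, Fintype.card_fin, ← hI] at this
    have h' : ((C.card + 1 + I.card : ℕ) : ℝ) = n := by exact_mod_cast this
    push_cast at h'
    linarith
  have hiso : ∀ u ∈ I, ∀ v, ¬ H.Adj u v :=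
    fun u hu v huv => Finset.mem_compl.1 hu (hsub u v huv)
  have hwd1 : (w : ℝ) + d ≤ I.card := by
    rw [hIcard]
    refine le_trans ?_ hwd
    exact le_mul_of_one_le_right (by positivity) hR.le
  have hwpos : 0 < w := Nat.ceil_pos.2 (by positivity)
  have hwdI : w + d ≤ I.card := by exact_mod_cast hwd1
  have hprod : m ≤ edgeCount H + w * d := by
    have h1 : (C.card : ℝ) / (8 * R) ≤ w := Nat.le_ceil _
    have h2 : 8 * ((m - m₁ : ℕ) : ℝ) * R / C.card ≤ d := Nat.le_ceil _
    have h3 : ((m - m₁ : ℕ) : ℝ) ≤ ((w * d : ℕ) : ℝ) := by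
      push_cast
      calc ((m - m₁ : ℕ) : ℝ) =
            (C.card : ℝ) / (8 * R) * (8 * ((m - m₁ : ℕ) : ℝ) * R / C.card) := by
            field_simp
        _ ≤ w * d := by gcongr
    have h4 : m - m₁ ≤ w * d := by exact_mod_cast h3
    omega
  obtain ⟨H', W, D, hW, hD, hWw, hDd, hle, hH', hdiff⟩ := exists_add_bipartite (m := m) hiso hwdI
    (by omega) hprod
  refine ⟨H, H', hH, hH', fun a => ?_⟩
  -- Up to time `C.card / 4` at least half of the clique is unrevealed, and this time still exceeds
  -- `R` up to rounding.
  have hmain := a.sum_successProb_le_of_clique (ε := ε) (p := ENNReal.ofReal R⁻¹)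
    (τ := C.card / 4) (by rw [hH, hH']; exact NoCommonEstimate.of_lt hsep) hclique hiso hW hD hle
    hdiff (fun t ht => by omega) ?_ (Finset.card_pos.1 (by omega)) ?_
  · refine hmain.trans ?_
    gcongr with π
    refine ENNReal.inv_le_inv.1 (natCast_inv_le_ofReal_inv ?_)
    have h1 : C.card ≤ 4 * (C.card / 4 + 1) := by omega
    have h2 : (C.card : ℝ) ≤ 4 * ((C.card / 4 + 1 : ℕ) : ℝ) := by exact_mod_cast h1
    linarith
  · intro t ht
    rw [hWw]
    have h1 : C.card ≤ 2 * (C.card - 2 * t) := by omega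
    have h2 : (C.card : ℝ) ≤ 2 * ((C.card - 2 * t : ℕ) : ℝ) := by exact_mod_cast h1
    have h3 := natCast_le_ofReal_mul (b := 2 * w) (k := C.card - 2 * t) (ρ := R⁻¹)
      (inv_nonneg.2 (by linarith)) (by
        rw [inv_mul_eq_div, le_div_iff₀ (by linarith)]
        push_cast
        linarith)
    simpa using h3
  · refine natCast_le_ofReal_mul (inv_nonneg.2 (by linarith)) ?_
    rw [hIcard, inv_mul_eq_div, le_div_iff₀ (by linarith)]
    refine le_trans ?_ hwd
    gcongr
    have := Finset.card_union_le W D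
    rw [hWw, hDd] at this
    exact_mod_cast this

end EdgeEstimation

/-! ### Choice of the regime. -/

open EdgeEstimation in
theorem mainTheorem2 (n m : ℕ) (hm : 1 ≤ m) (hmn : m ≤ n.choose 2)
    (ε : ℝ) (hε : 0 < ε) (hε' : ε ≤ 9 / 10)
    {Ω : Type*} [MeasurableSpace Ω] (P : MeasureTheory.Measure Ω)
    [MeasureTheory.IsProbabilityMeasure P] (A : RandAlgorithm n Ω) :
    ∃ G : SimpleGraph (Fin n),
      (1 - ε) * m ≤ (1 + ε) * ((edgeCount G : ℝ) + 1) ∧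
      (1 - ε) * ((edgeCount G : ℝ) - 1) ≤ (1 + ε) * m ∧
      A.successProb P G ε ≤
        1 / 2 + A.expectedQueries P G / ENNReal.ofReal (rate n m ε) ∧
      A.successProb P G ε ≤
        1 / 2 + A.expectedQueries P G / ENNReal.ofReal (rate n (edgeCount G) ε) := by
  obtain ⟨m₁, hsep, hsep'⟩ := exists_lower_count hm hε hε'
  have hm0 : (1 : ℝ) ≤ m := by exact_mod_cast hm
  have hm₁0 : (0 : ℝ) ≤ m₁ := Nat.cast_nonneg m₁
  have hm₁m : m₁ < m := by
    have : (m₁ : ℝ) < m := by nlinarith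
    exact_mod_cast this
  have hm₁m' : (m₁ : ℝ) + 1 ≤ m := by exact_mod_cast hm₁m
  have finish : ∀ {k : ℕ}, (k = m ∨ k = m₁) → ∀ {ρ : ℝ≥0∞},
      ρ ≤ (ENNReal.ofReal (rate n m ε))⁻¹ → ρ ≤ (ENNReal.ofReal (rate n k ε))⁻¹ →
      ∀ {H : SimpleGraph (Fin n)}, edgeCount H = k →
      (∃ π, A.successProb P (permute π H) ε ≤ 1 / 2 + ρ * A.expectedQueries P (permute π H)) →
      ∃ G : SimpleGraph (Fin n),
        (1 - ε) * m ≤ (1 + ε) * ((edgeCount G : ℝ) + 1) ∧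
        (1 - ε) * ((edgeCount G : ℝ) - 1) ≤ (1 + ε) * m ∧
        A.successProb P G ε ≤
          1 / 2 + A.expectedQueries P G / ENNReal.ofReal (rate n m ε) ∧
        A.successProb P G ε ≤
          1 / 2 + A.expectedQueries P G / ENNReal.ofReal (rate n (edgeCount G) ε) := by
    intro k hk ρ h1 h2 H hH ⟨π, hπ⟩
    refine ⟨permute π H, ?_⟩
    rw [edgeCount_permute, hH]
    refine ⟨?_, ?_, hπ.trans ?_, hπ.trans ?_⟩
    · rcases hk with rfl | rfl
      · nlinarith
      · exact hsep'
    · rcases hk with rfl | rfl <;> nlinarith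
    · refine add_le_add le_rfl ?_
      rw [div_eq_mul_inv, mul_comm ρ]
      gcongr
    · refine add_le_add le_rfl ?_
      rw [div_eq_mul_inv, mul_comm ρ]
      gcongr
  by_cases hR : rate n m ε ≤ 1
  · obtain ⟨H, H', hH, hH', hsum⟩ := hardPair_trivial hmn (hm₁m.le.trans hmn) hsep
    have hle : 1 ≤ (ENNReal.ofReal (rate n m ε))⁻¹ := by
      rw [ENNReal.one_le_inv]
      exact ENNReal.ofReal_le_one.2 hR
    rcases exists_permute_successProb_le hsum P A with h | h
    · exact finish (Or.inr rfl) zero_le zero_le hH h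
    · exact finish (Or.inl rfl) hle hle hH' h
  rw [not_le] at hR
  have hRs := rate_le n m ε
  by_cases hn : (n : ℝ) ≤ 16 * Real.sqrt m
  -- On the graph with `m₁` edges both rates must be beaten, hence the maximum.
  · obtain ⟨τ, hτ⟩ := exists_nat_ge (max (rate n m ε) (rate n m₁ ε))
    have hτ' : max (rate n m ε) (rate n m₁ ε) ≤ ((τ + 1 : ℕ) : ℝ) := by
      push_cast
      linarith
    obtain ⟨H, H', hH, hH', hsum⟩ := hardPair_dense hm hmn hε hm₁m hsep hsep' hn hR τ
    have hle : ENNReal.ofReal (rate n m ε)⁻¹ ≤ (ENNReal.ofReal (rate n m ε))⁻¹ :=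
      le_ofReal_inv (inv_nonneg.2 (by linarith)) (inv_mul_cancel₀ (by linarith)).le
    rcases exists_permute_successProb_le hsum P A with h | h
    · exact finish (Or.inl rfl) hle hle hH h
    · exact finish (Or.inr rfl) (natCast_inv_le_ofReal_inv ((le_max_left _ _).trans hτ'))
        (natCast_inv_le_ofReal_inv ((le_max_right _ _).trans hτ')) hH' h
  · rw [not_le] at hn
    have hm₁ : 1 ≤ m₁ := by
      have h1 : (900 : ℝ) < m := by
        rw [← Real.sq_sqrt (Nat.cast_nonneg (α := ℝ) m)]
        nlinarith
      have h2 : (0 : ℝ) < m₁ := by nlinarith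
      exact_mod_cast h2
    have hsqrt : Real.sqrt m₁ ≤ Real.sqrt m := Real.sqrt_le_sqrt (by linarith)
    -- One `R` settles both conclusions on whichever graph is chosen; the bounds below use `m₁ ≤ m`.
    set R := max (rate n m ε) (rate n m₁ ε) with hRdef
    have hR1 : 1 < R := hR.trans_le (le_max_left _ _)
    have hRs' : 30 * R ≤ Real.sqrt m := by
      rcases max_choice (rate n m ε) (rate n m₁ ε) with h | h <;> rw [hRdef, h]
      · exact hRs
      · exact (rate_le n m₁ ε).trans hsqrt
    have hRn : 900 * R ^ 2 * (ε * Real.sqrt m₁) ≤ n := by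
      rcases max_choice (rate n m ε) (rate n m₁ ε) with h | h <;> rw [hRdef, h]
      · refine le_trans ?_ (sq_rate_mul_le hm hε)
        gcongr
      · exact sq_rate_mul_le hm₁ hε
    obtain ⟨H, H', hH, hH', hsum⟩ :=
      hardPair_sparse hmn hε hε' hm₁ hm₁m hsep hsep' hn hR1 hRs' hRn
    have hle : ∀ {r : ℝ}, r ≤ R → ENNReal.ofReal R⁻¹ ≤ (ENNReal.ofReal r)⁻¹ := by
      intro r hr
      refine le_ofReal_inv (inv_nonneg.2 (by linarith)) ?_
      rw [inv_mul_eq_div, div_le_one (by linarith)]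
      exact hr
    have hle' : (ENNReal.ofReal R)⁻¹ ≤ (ENNReal.ofReal (rate n m ε))⁻¹ :=
      ENNReal.inv_le_inv.2 (ENNReal.ofReal_le_ofReal (le_max_left _ _))
    rcases exists_permute_successProb_le hsum P A with h | h
    · exact finish (Or.inr rfl) (hle (le_max_left _ _)) (hle (le_max_right _ _)) hH h
    · exact finish (Or.inl rfl) hle' hle' hH' h
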